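/- Let $n\ge 2$ and let $f=f_0x_1^n+f_1x_1^{n-1}x_2+\dots+f_nx_2^n$ be a non-zero binary $n$-ic form with integer coefficients. Let $T_f\subset\mathbb P^1_{\mathbb Z}$ be the subscheme cut out by $f$, and put $R_f=\Gamma(T_f,\mathcal O)$, $I_f=\Gamma(T_f,\mathcal O(n-3))$, $J_f=\Gamma(T_f,\mathcal O(n-2))$; here $I_f$ and $J_f$ are $R_f$-modules. Let $I_f\to V=\mathbb Z^2$ be the connecting map $\Gamma(T_f,\mathcal O(n-3))\to H^1(\mathbb P^1_{\mathbb Z},\mathcal O(-3))$ of $0\to\mathcal O(-3)\xrightarrow{f}\mathcal O(n-3)\to\mathcal O_{T_f}(n-3)\to0$. In coordinates: with $T=x_1/x_2$, if a section is represented by polynomials $a\in\mathbb Z[T]$ and $b\in\mathbb Z[T^{-1}]$ on the two standard charts, then $a-T^{n-3}b=f(T,1)\,q$ with $q\in\mathbb Z[T,T^{-1}]$, and the section maps to (the coefficient of $T^{-1}$ in $q$, minus the coefficient of $T^{-2}$ in $q$). Let $M$ and $N$ be $R_f$-modules, each free of rank $n$ over $\mathbb Z$, with an $R_f$-module map $\varphi:M\otimes_{R_f}N\to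 I_f$. Choosing $\mathbb Z$-bases of $M$ and $N$, write the composite $M\otimes_{\mathbb Z}N\to M\otimes_{R_f}N\to I_f\to V$ as a pair $A_1,A_2$ of integral $n\times n$ matrices. The data $(M,N,\varphi)$ is a *balanced pair of modules for $f$* if $\det(A_1x_1+A_2x_2)=\pm f$. An $R_f$-module that is free of rank $n$ over $\mathbb Z$ is *characteristic* if every $\zeta\in R_f$ acts on it and on $R_f$ (which is also free of rank $n$ over $\mathbb Z$) with the same characteristic polynomial over $\mathbb Z$. **Proposition.** There exists an injective $R_f$-module map $I_f\to J_f$. For every such map $\iota:I_f\hookrightarrow J_f$, the data $(M,N,\varphi)$ is a balanced pair of modules for $f$ if and only if the following three conditions hold: 1. $M\subset\operatorname{Hom}_{R_f}(N,I_f)$, i.e. the map $M\to\operatorname{Hom}_{R_f}(N,I_f)$ induced by $\varphi$ is injective; 2. $[\operatorname{Hom}_{R_f}(N,J_f):M]=[J_f:I_f]$, where $I_f$ is regarded as a submodule of $J_f$ via $\iota$, and $M$ is mapped to $\operatorname{Hom}_{R_f}(N,J_f)$ by the map induced by $\iota\circ\varphi$; 3. $M$ or $N$ is characteristic. -/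

import Mathlib

open Polynomial LaurentPolynomial TensorProduct

noncomputable section

namespace BinaryForm

/-- The binary `n`-ic form `f₀ x₁ⁿ + f₁ x₁ⁿ⁻¹ x₂ + ⋯ + fₙ x₂ⁿ` with integer coefficients `fᵢ`,
as a polynomial in two variables.  The form itself is represented by its coefficient vector. -/
def toMvPolynomial {n : ℕ} (f : Fin (n + 1) → ℤ) : MvPolynomial (Fin 2) ℤ :=
  ∑ i : Fin (n + 1),
    MvPolynomial.C (f i) * MvPolynomial.X 0 ^ (n - (i : ℕ)) * MvPolynomial.X 1 ^ (i : ℕ)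

/-- `F(T, 1)`: the equation of `T_f ⊂ ℙ¹` on the chart `x₂ ≠ 0`, with coordinate `T = x₁ / x₂`. -/
def dehom₂ {n : ℕ} (f : Fin (n + 1) → ℤ) : ℤ[X] :=
  ∑ i : Fin (n + 1), Polynomial.C (f i) * X ^ (n - (i : ℕ))

/-- `F(1, S)`: the equation of `T_f ⊂ ℙ¹` on the chart `x₁ ≠ 0`, with coordinate `S = x₂ / x₁`. -/
def dehom₁ {n : ℕ} (f : Fin (n + 1) → ℤ) : ℤ[X] :=
  ∑ i : Fin (n + 1), Polynomial.C (f i) * X ^ (i : ℕ)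

/-- Functions on the chart `x₂ ≠ 0` of `T_f`. -/
abbrev Chart₂ {n : ℕ} (f : Fin (n + 1) → ℤ) : Type := ℤ[X] ⧸ Ideal.span {dehom₂ f}

/-- Functions on the chart `x₁ ≠ 0` of `T_f`. -/
abbrev Chart₁ {n : ℕ} (f : Fin (n + 1) → ℤ) : Type := ℤ[X] ⧸ Ideal.span {dehom₁ f}

/-- Functions on the overlap `x₁ x₂ ≠ 0` of the two charts of `T_f`. -/
abbrev Overlap {n : ℕ} (f : Fin (n + 1) → ℤ) : Type :=
  ℤ[T;T⁻¹] ⧸ Ideal.span {toLaurent (dehom₂ f)}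

/-- The substitution `S ↦ T⁻¹`, from polynomials in `S` to Laurent polynomials in `T`. -/
def subInv : ℤ[X] →+* ℤ[T;T⁻¹] :=
  (LaurentPolynomial.invert (R := ℤ)).toRingEquiv.toRingHom.comp toLaurent

/-- `F(1, T⁻¹) = T⁻ⁿ F(T, 1)`. -/
lemma subInv_dehom₁ {n : ℕ} (f : Fin (n + 1) → ℤ) :
    subInv (dehom₁ f) = T (-(n : ℤ)) * toLaurent (dehom₂ f) := by
  simp only [subInv, dehom₁, dehom₂, map_sum, map_mul, map_pow, Finset.mul_sum]
  refine Finset.sum_congr rfl fun i _ => ?_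
  have hi : (i : ℕ) ≤ n := Nat.lt_succ_iff.mp i.2
  simp only [RingEquiv.toRingHom_eq_coe, RingHom.comp_apply, toLaurent_C, toLaurent_X]
  change LaurentPolynomial.invert _ * LaurentPolynomial.invert _ ^ _ = _
  rw [invert_C, invert_T, T_pow, T_pow, mul_left_comm, ← T_add]
  congr 2
  push_cast [hi]
  ring

/-- Restriction of functions from the chart `x₂ ≠ 0` to the overlap. -/
def res₂ {n : ℕ} (f : Fin (n + 1) → ℤ) : Chart₂ f →+* Overlap f :=
  Ideal.quotientMap _ toLaurent (by
    rw [Ideal.span_singleton_le_iff_mem, Ideal.mem_comap]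
    exact Ideal.mem_span_singleton_self _)

/-- Restriction of functions from the chart `x₁ ≠ 0` to the overlap. -/
def res₁ {n : ℕ} (f : Fin (n + 1) → ℤ) : Chart₁ f →+* Overlap f :=
  Ideal.quotientMap _ subInv (by
    rw [Ideal.span_singleton_le_iff_mem, Ideal.mem_comap, subInv_dehom₁]
    exact Ideal.mul_mem_left _ _ (Ideal.mem_span_singleton_self _))

/-- The global functions of `T_f`, as pairs of functions on the two charts that agree on the
overlap. -/
def globalFunctions {n : ℕ} (f : Fin (n + 1) → ℤ) : Subring (Chart₂ f × Chart₁ f) :=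
  RingHom.eqLocus ((res₂ f).comp (RingHom.fst _ _)) ((res₁ f).comp (RingHom.snd _ _))

/-- The ring `R_f = Γ(T_f, 𝒪)` of global functions of the subscheme `T_f ⊂ ℙ¹` cut out by `f`. -/
abbrev R {n : ℕ} (f : Fin (n + 1) → ℤ) : Type := globalFunctions f

/-- `Γ(T_f, 𝒪(k))` as an `R_f`-module: a section `s` is given by `a = s / x₂ᵏ` on the chart
`x₂ ≠ 0` and `b = s / x₁ᵏ` on the chart `x₁ ≠ 0`, subject to `a = Tᵏ b` on the overlap. -/
def sections {n : ℕ} (f : Fin (n + 1) → ℤ) (k : ℤ) : Submodule (R f) (Chart₂ f × Chart₁ f) where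
  carrier := {s | res₂ f s.1 = Ideal.Quotient.mk _ (T k) * res₁ f s.2}
  zero_mem' := by simp
  add_mem' := by
    intro a b ha hb
    simp only [Set.mem_ofPred_eq, Prod.fst_add, Prod.snd_add, map_add] at ha hb ⊢
    rw [ha, hb, mul_add]
  smul_mem' := by
    rintro ⟨r, hr⟩ s hs
    have hr' : res₂ f r.1 = res₁ f r.2 := hr
    change res₂ f (r.1 * s.1) = _ * res₁ f (r.2 * s.2)
    have hs' : res₂ f s.1 = Ideal.Quotient.mk _ (T k) * res₁ f s.2 := hs
    rw [map_mul, map_mul, hr', hs', mul_left_comm]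

/-- `I_f = Γ(T_f, 𝒪(n - 3))`. -/
abbrev I {n : ℕ} (f : Fin (n + 1) → ℤ) : Type := sections f ((n : ℤ) - 3)

/-- `J_f = Γ(T_f, 𝒪(n - 2))`. -/
abbrev J {n : ℕ} (f : Fin (n + 1) → ℤ) : Type := sections f ((n : ℤ) - 2)

/-- `q` is the quotient by `F(T, 1)` of the difference on the overlap of lifts of the two halves
of `s` to sections of `𝒪(k)` on the charts of `ℙ¹`.  Thus `q` is a Čech cocycle that represents
the image of `s` under the connecting map `Γ(T_f, 𝒪(k)) → H¹(ℙ¹, 𝒪(k - n))` of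
`0 → 𝒪(k - n) → 𝒪(k) → 𝒪_{T_f}(k) → 0`. -/
def IsCocycle {n : ℕ} (f : Fin (n + 1) → ℤ) (k : ℤ) (s : sections f k) (q : ℤ[T;T⁻¹]) : Prop :=
  ∃ a b : ℤ[X], Ideal.Quotient.mk _ a = s.1.1 ∧ Ideal.Quotient.mk _ b = s.1.2 ∧
    toLaurent a - T k * subInv b = toLaurent (dehom₂ f) * q

lemma exists_isCocycle {n : ℕ} (f : Fin (n + 1) → ℤ) (k : ℤ) (s : sections f k) :
    ∃ q, IsCocycle f k s q := by
  obtain ⟨⟨s₁, s₂⟩, hs⟩ := s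
  obtain ⟨a, rfl⟩ := Ideal.Quotient.mk_surjective s₁
  obtain ⟨b, rfl⟩ := Ideal.Quotient.mk_surjective s₂
  have hs' : res₂ f (Ideal.Quotient.mk _ a) =
      Ideal.Quotient.mk _ (T k) * res₁ f (Ideal.Quotient.mk _ b) := hs
  rw [res₂, res₁, Ideal.quotientMap_mk, Ideal.quotientMap_mk, ← map_mul, Ideal.Quotient.eq,
    Ideal.mem_span_singleton'] at hs'
  obtain ⟨q, hq⟩ := hs'
  exact ⟨q, a, b, rfl, rfl, by rw [← hq, mul_comm]⟩

/-- The canonical map `I_f → V = ℤ²`: the class of the cocycle `q` in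
`H¹(ℙ¹, 𝒪(-3)) = ℤ T⁻¹ ⊕ ℤ T⁻²`, with coordinates the coefficient of `T⁻¹` and minus the
coefficient of `T⁻²`.  When `f₀ ≠ 0` this is `(ζ̌ₙ₋₁, -ζ̌ₙ₋₂)`. -/
def toV {n : ℕ} (f : Fin (n + 1) → ℤ) (s : I f) : Fin 2 → ℤ :=
  ![(exists_isCocycle f _ s).choose.coeff (-1), -(exists_isCocycle f _ s).choose.coeff (-2)]

lemma dehom₂_ne_zero {n : ℕ} {f : Fin (n + 1) → ℤ} (hf : f ≠ 0) : dehom₂ f ≠ 0 := by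
  contrapose! hf
  ext i
  have h := congrArg (fun p => Polynomial.coeff p (n - (i : ℕ))) hf
  simp only [dehom₂, Polynomial.finsetSum_coeff, Polynomial.coeff_C_mul_X_pow,
    Polynomial.coeff_zero] at h
  rw [Finset.sum_eq_single i] at h
  · simpa using h
  · intro j _ hj
    rw [if_neg]
    intro h'
    apply hj
    ext
    omega
  · simp

/-- The map to `V` does not depend on the choice of the cocycle. -/
lemma toV_eq {n : ℕ} {f : Fin (n + 1) → ℤ} (hf : f ≠ 0) (s : I f) {q : ℤ[T;T⁻¹]}
    (hq : IsCocycle f _ s q) : toV f s = ![q.coeff (-1), -q.coeff (-2)] := by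
  have key : ∀ q₁ q₂ : ℤ[T;T⁻¹], IsCocycle f _ s q₁ → IsCocycle f _ s q₂ →
      ∀ m : ℤ, m < 0 → -3 < m → q₁.coeff m = q₂.coeff m := by
    rintro q₁ q₂ ⟨a₁, b₁, ha₁, hb₁, h₁⟩ ⟨a₂, b₂, ha₂, hb₂, h₂⟩ m hm hm'
    rw [← ha₂, Ideal.Quotient.eq, Ideal.mem_span_singleton'] at ha₁
    rw [← hb₂, Ideal.Quotient.eq, Ideal.mem_span_singleton'] at hb₁
    obtain ⟨u, hu⟩ := ha₁
    obtain ⟨v, hv⟩ := hb₁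
    have hg : toLaurent (dehom₂ f) ≠ 0 := Polynomial.toLaurent_ne_zero.mpr (dehom₂_ne_zero hf)
    have hT : (T ((n : ℤ) - 3) * T (-(n : ℤ)) : ℤ[T;T⁻¹]) = T (-3) := by
      rw [← T_add]; congr 1; ring
    have e : q₁ - q₂ = toLaurent u - T (-3) * subInv v := by
      apply mul_left_cancel₀ hg
      have hu' := congrArg toLaurent hu
      have hv' := congrArg subInv hv
      rw [map_mul, map_sub] at hu' hv'
      rw [subInv_dehom₁] at hv'
      rw [← hT]
      linear_combination (exp := 1) h₂ - h₁ - hu' + T ((n : ℤ) - 3) * hv'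
    have e' := congrArg (fun p => AddMonoidAlgebra.coeff p m) e
    have h1 : (toLaurent u).coeff m = 0 := by
      by_contra h
      have := Finsupp.mem_support_iff.mpr h
      rw [support_coeff_toLaurent] at this
      simp at this
      obtain ⟨x, _, hx⟩ := this
      omega
    have h2 : (T (-3) * subInv v : ℤ[T;T⁻¹]).coeff m = 0 := by
      have : (T (-3) * subInv v : ℤ[T;T⁻¹]).coeff m = (subInv v).coeff (3 + m) := by
        have := AddMonoidAlgebra.coeff_single_mul_apply (subInv v) (1 : ℤ) (-3 : ℤ) m
        rw [one_mul, neg_neg] at this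
        exact this
      rw [this]
      change (LaurentPolynomial.invert (toLaurent v)).coeff _ = 0
      rw [invert_apply]
      by_contra h
      have := Finsupp.mem_support_iff.mpr h
      rw [support_coeff_toLaurent] at this
      simp at this
      obtain ⟨x, _, hx⟩ := this
      omega
    have : q₁.coeff m - q₂.coeff m = 0 := by
      have : (q₁ - q₂).coeff m = 0 := by
        rw [e]
        change (toLaurent u).coeff m - (T (-3) * subInv v : ℤ[T;T⁻¹]).coeff m = 0
        rw [h1, h2, sub_zero]
      exact this
    exact sub_eq_zero.mp this
  have hc := (exists_isCocycle f _ s).choose_spec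
  rw [toV, key _ _ hc hq (-1) (by norm_num) (by norm_num),
    key _ _ hc hq (-2) (by norm_num) (by norm_num)]

variable {n : ℕ} {f : Fin (n + 1) → ℤ}

/-- The pair of matrices `A₁, A₂` of the composite `M ⊗ N → I_f → V` in given `ℤ`-bases of `M`
and `N` (`i = 0, 1` stands for `A₁, A₂`). -/
def balancingMatrix {M N : Type*} [AddCommGroup M] [AddCommGroup N] [Module (R f) M]
    [Module (R f) N] (φ : M ⊗[R f] N →ₗ[R f] I f) (b : Module.Basis (Fin n) ℤ M)
    (c : Module.Basis (Fin n) ℤ N) (i : Fin 2) : Matrix (Fin n) (Fin n) ℤ :=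
  Matrix.of fun j k => toV f (φ (b j ⊗ₜ[R f] c k)) i

/-- `Det(A₁ x₁ + A₂ x₂)` for a pair of square integral matrices. -/
def detForm (A : Fin 2 → Matrix (Fin n) (Fin n) ℤ) : MvPolynomial (Fin 2) ℤ :=
  Matrix.det ((MvPolynomial.X 0 : MvPolynomial (Fin 2) ℤ) • (A 0).map MvPolynomial.C +
    (MvPolynomial.X 1 : MvPolynomial (Fin 2) ℤ) • (A 1).map MvPolynomial.C)

/-- The `R_f`-modules `M`, `N`, both free of rank `n` over `ℤ`, with `φ : M ⊗_{R_f} N → I_f`, form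
a balanced pair of modules for `f`: `Det(A₁ x₁ + A₂ x₂) = ± f`. -/
def IsBalancedPair {M N : Type*} [AddCommGroup M] [AddCommGroup N] [Module (R f) M]
    [Module (R f) N] (φ : M ⊗[R f] N →ₗ[R f] I f) : Prop :=
  ∃ (b : Module.Basis (Fin n) ℤ M) (c : Module.Basis (Fin n) ℤ N),
    detForm (balancingMatrix φ b c) = toMvPolynomial f ∨
      detForm (balancingMatrix φ b c) = -toMvPolynomial f

/-- The `R_f`-module `M` is characteristic: it is free of rank `n` over `ℤ`, as is `R_f`, and every
`ζ ∈ R_f` acts on `M` and on `R_f` with the same characteristic polynomial over `ℤ`. -/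
def IsCharacteristic (f : Fin (n + 1) → ℤ) (M : Type*) [AddCommGroup M] [Module (R f) M] : Prop :=
  ∃ (b : Module.Basis (Fin n) ℤ M) (c : Module.Basis (Fin n) ℤ (R f)), ∀ ζ : R f,
    (LinearMap.toMatrix b b (Algebra.lsmul ℤ ℤ M ζ)).charpoly =
      (LinearMap.toMatrix c c (Algebra.lsmul ℤ ℤ (R f) ζ)).charpoly

/-- The map `M → Hom_{R_f}(N, P)` induced by `M ⊗_{R_f} N → I_f` and an `R_f`-linear map
`ι : I_f → P`. -/
def toHom {M N P : Type*} [AddCommGroup M] [AddCommGroup N] [AddCommGroup P] [Module (R f) M]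
    [Module (R f) N] [Module (R f) P] (φ : M ⊗[R f] N →ₗ[R f] I f) (ι : I f →ₗ[R f] P) :
    M →ₗ[R f] (N →ₗ[R f] P) :=
  TensorProduct.curry (ι ∘ₗ φ)

end BinaryForm

end

/-! A Čech residue makes `J_f` the `ℤ`-dual of `R_f`, so `Hom_{R_f}(N, J_f)` is the `ℤ`-dual of `N`,
and the index of `M` in it is the absolute determinant of the pairing `M × N → I_f → J_f → ℤ`
(`index_range_toHom`). If `I_f → J_f` is multiplication by `u x₁ + v x₂`, the matrix of this pairing
is `v A₁ - u A₂` (`residue_mulIJ`). Taking `(u, v) = (-x₂, x₁)`, explicit bases show that the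
canonical pair `(I_f, R_f)` has form `-f` (`detForm_canonical`), so being balanced means having the
same form as the canonical pair up to sign.

Choose an integer `t` with `f(t, 1) ≠ 0`. Multiplication by `x₁ - t x₂` is then injective, and `ζ =
d x₂ / (x₁ - t x₂)` lies in `R_f` for some integer `d ≠ 0`. With `P` the pairing matrix for `x₁ - t
x₂` and `Z` the action of `ζ` on `N`, one has `d (A₁ x₁ + A₂ x₂) = P ((x₁ - t x₂) Z - d x₂)`. So,
when `det P ≠ 0`, the form carries the same information as `det P` together with the characteristic
polynomial of `ζ` on `N` (`C_pow_mul_detForm`). The latter determines the characteristic polynomials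
of all functions, since each is, up to an integer factor, a polynomial in `ζ`
(`exists_smul_eq_aeval`).

An arbitrary injective `ι` is, up to an integer factor, `x₁ - t x₂` times some `κ ∈ R_f`. Once
characteristic polynomials agree, passing between the two maps changes the determinants for `(M, N)`
and for `(I_f, R_f)` by the same factor (`exists_detForm_eq_iff`). Finally, functions are
self-adjoint for the pairing, so if it is non-degenerate, `M` is characteristic exactly when `N` is.
-/

noncomputable section

namespace BinaryForm

/-! ### Characteristic polynomials of integral matrices, and indices of lattices -/

section MatrixLemmas

variable {α : Type*} [Fintype α] [DecidableEq α]

/-- Both sides are multiplicative in `p`, which splits, and for a linear factor `det (A - a)` is up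
to sign the value of the characteristic polynomial at `a`. -/
lemma det_aeval_eq_of_charpoly_eq {K : Type*} [Field K] [IsAlgClosed K] {A B : Matrix α α K}
    (h : A.charpoly = B.charpoly) (p : K[X]) : (aeval A p).det = (aeval B p).det := by
  have key : ∀ s : Multiset K,
      (aeval A (s.map fun a => X - Polynomial.C a).prod).det =
        (aeval B (s.map fun a => X - Polynomial.C a).prod).det := by
    intro s
    induction s using Multiset.induction_on with
    | empty => simp
    | cons a s ih =>
      have e : ∀ Z : Matrix α α K, (aeval Z (X - Polynomial.C a)).det =
          (-1) ^ Fintype.card α * Z.charpoly.eval a := by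
        intro Z
        rw [Matrix.eval_charpoly, ← Matrix.det_neg, neg_sub]
        congr 1
        simp [Matrix.algebraMap_eq_diagonal, Matrix.scalar_apply]
      rw [Multiset.map_cons, Multiset.prod_cons, map_mul, map_mul, Matrix.det_mul, Matrix.det_mul,
        ih, e, e, h]
  rw [(IsAlgClosed.splits p).eq_prod_roots, map_mul, map_mul, Matrix.det_mul, Matrix.det_mul, key]
  congr 1
  simp [Matrix.algebraMap_eq_diagonal]

lemma charpoly_aeval_eq_of_charpoly_eq_of_isAlgClosed {K : Type*} [Field K] [IsAlgClosed K]
    {A B : Matrix α α K} (h : A.charpoly = B.charpoly) (p : K[X]) :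
    (aeval A p).charpoly = (aeval B p).charpoly := by
  apply Polynomial.funext
  intro x
  have e : ∀ Z : Matrix α α K, (aeval Z p).charpoly.eval x =
      (aeval Z (Polynomial.C x - p)).det := by
    intro Z
    rw [Matrix.eval_charpoly, map_sub, aeval_C, Matrix.algebraMap_eq_diagonal, Matrix.scalar_apply]
    rfl
  rw [e, e, det_aeval_eq_of_charpoly_eq h]

/-- The characteristic polynomial of `p(A)` depends only on that of `A`. -/
lemma charpoly_aeval_eq_of_charpoly_eq {A B : Matrix α α ℤ}
    (h : A.charpoly = B.charpoly) (p : ℤ[X]) :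
    (aeval A p).charpoly = (aeval B p).charpoly := by
  -- `ℤ` embeds in an algebraically closed field, where polynomials split.
  let g := algebraMap ℤ (AlgebraicClosure ℚ)
  have hg : Function.Injective g := FaithfulSMul.algebraMap_injective _ _
  apply Polynomial.map_injective g hg
  have e : ∀ Z : Matrix α α ℤ, g.mapMatrix (aeval Z p) = aeval (g.mapMatrix Z) (p.map g) := by
    intro Z
    rw [aeval_def, aeval_def, hom_eval₂, eval₂_map]
    congr 1
    exact RingHom.ext_int _ _
  have e' : ∀ Z : Matrix α α ℤ, (aeval Z p).charpoly.map g =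
      (aeval (g.mapMatrix Z) (p.map g)).charpoly := by
    intro Z
    rw [← e, RingHom.mapMatrix_apply, Matrix.charpoly_map]
  rw [e', e']
  apply charpoly_aeval_eq_of_charpoly_eq_of_isAlgClosed
  simp only [RingHom.mapMatrix_apply, Matrix.charpoly_map, h]

/-- `det (d X - d A) = dᵐ det (X - A)` for size `m`; this serves to clear integer denominators. -/
lemma charpoly_smul_comp {S : Type*} [CommRing S] (A : Matrix α α S) (d : S) :
    (d • A).charpoly.comp (Polynomial.C d * X) =
      Polynomial.C d ^ Fintype.card α * A.charpoly := by
  rw [Matrix.charpoly, Matrix.charpoly, ← Matrix.det_smul]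
  change (compRingHom (Polynomial.C d * X)) _ = _
  rw [RingHom.map_det]
  congr 1
  ext1 i j
  by_cases hij : i = j
  · subst hij; simp; ring
  · simp [hij]

lemma comp_C_mul_X_injective {d : ℤ} (hd : d ≠ 0) :
    Function.Injective fun p : ℤ[X] => p.comp (Polynomial.C d * X) := by
  intro p q h
  ext i
  have := congrArg (fun p => p.coeff i) h
  simp only [comp_C_mul_X_coeff] at this
  exact mul_right_cancel₀ (pow_ne_zero i hd) this

lemma charpoly_eq_of_charpoly_smul_eq {A B : Matrix α α ℤ} {d : ℤ} (hd : d ≠ 0)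
    (h : (d • A).charpoly = (d • B).charpoly) : A.charpoly = B.charpoly := by
  have h' := congrArg (fun p => p.comp (Polynomial.C d * X)) h
  simp only [charpoly_smul_comp] at h'
  exact mul_left_cancel₀ (pow_ne_zero _ (by simpa using hd)) h'

/-- Over the fraction field, `det (u A - v)` is a power of `-u` times the characteristic polynomial
at `v / u`. -/
lemma det_smul_sub_eq_of_charpoly_eq {S : Type*} [CommRing S] [IsDomain S] {A B : Matrix α α ℤ}
    (h : A.charpoly = B.charpoly) {u : S} (hu : u ≠ 0) (v : S) :
    (u • A.map (Int.castRingHom S) - v • (1 : Matrix α α S)).det =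
      (u • B.map (Int.castRingHom S) - v • (1 : Matrix α α S)).det := by
  let K := FractionRing S
  let g := algebraMap S K
  have hg : Function.Injective g := FaithfulSMul.algebraMap_injective _ _
  have hu' : g u ≠ 0 := by simpa [g] using hu
  apply hg
  have e : ∀ Z : Matrix α α ℤ, g (u • Z.map (Int.castRingHom S) - v • (1 : Matrix α α S)).det =
      (-g u) ^ Fintype.card α * (Z.charpoly.map (Int.castRingHom K)).eval (g v / g u) := by
    intro Z
    rw [RingHom.map_det, ← Matrix.charpoly_map, Matrix.eval_charpoly, ← Matrix.det_smul]
    congr 1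
    ext i j
    have hv : g u * (g v / g u) = g v := mul_div_cancel₀ _ hu'
    by_cases hij : i = j
    · subst hij; simp; linear_combination hv
    · simp [hij]; ring
  rw [e, e, h]

lemma charpoly_eq_of_det_sub_eq {A B : Matrix α α ℤ} {d : ℤ} (hd : d ≠ 0)
    (h : (A.map (Int.castRingHom ℤ[X]) - (Polynomial.C d * X) • (1 : Matrix α α ℤ[X])).det =
      (B.map (Int.castRingHom ℤ[X]) - (Polynomial.C d * X) • (1 : Matrix α α ℤ[X])).det) :
    A.charpoly = B.charpoly := by
  apply comp_C_mul_X_injective hd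
  have e : ∀ Z : Matrix α α ℤ, Z.charpoly.comp (Polynomial.C d * X) = (-1) ^ Fintype.card α *
      (Z.map (Int.castRingHom ℤ[X]) - (Polynomial.C d * X) • (1 : Matrix α α ℤ[X])).det := by
    intro Z
    rw [← Matrix.det_neg]
    change (compRingHom (Polynomial.C d * X)) _ = _
    rw [Matrix.charpoly, RingHom.map_det]
    congr 1
    ext1 i j
    by_cases hij : i = j
    · subst hij; simp
    · simp [hij]
  simp only [e, h]

/-- The index of the range of a linear map between free `ℤ`-modules is its determinant. -/
lemma index_range_eq_natAbs_det {P Q : Type*} [AddCommGroup P] [AddCommGroup Q]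
    (b : Module.Basis α ℤ P) (c : Module.Basis α ℤ Q) (g : P →ₗ[ℤ] Q) :
    (LinearMap.range g).toAddSubgroup.index = (LinearMap.toMatrix b c g).det.natAbs := by
  -- A left null vector gives a functional that vanishes on the range. Were the index non-zero,
  -- multiples of all basis vectors would lie in the range and the functional would be zero. So the
  -- index has its value `0` for infinite quotients.
  by_cases hd : (LinearMap.toMatrix b c g).det = 0
  · rw [hd, Int.natAbs_zero]
    obtain ⟨v, hv, hv'⟩ := Matrix.exists_vecMul_eq_zero_iff.mpr hd
    let l : Q →ₗ[ℤ] ℤ := c.constr ℤ v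
    have hl : l ∘ₗ g = 0 := by
      refine b.ext fun j => ?_
      have := congrFun hv' j
      rw [LinearMap.comp_apply, ← c.sum_repr (g (b j)), map_sum]
      simp only [map_smul, l, Module.Basis.constr_basis, LinearMap.zero_apply]
      rw [Pi.zero_apply, Matrix.vecMul, dotProduct] at this
      rw [← this]
      refine Finset.sum_congr rfl fun i _ => ?_
      rw [LinearMap.toMatrix_apply, smul_eq_mul, mul_comm]
    by_contra hne
    apply hv
    ext i
    have hm := AddSubgroup.nsmul_index_mem (LinearMap.range g).toAddSubgroup (c i)
    obtain ⟨x, hx⟩ := hm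
    have h0 : l (g x) = 0 := LinearMap.congr_fun hl x
    rw [hx, map_nsmul] at h0
    simp only [l, Module.Basis.constr_basis, smul_eq_zero] at h0
    exact h0.resolve_left hne
  · have hinj : Function.Injective g := by
      rw [← LinearMap.ker_eq_bot, LinearMap.ker_eq_bot']
      intro x hx
      have h1 : (LinearMap.toMatrix b c g).mulVec (b.repr x) = 0 := by
        rw [LinearMap.toMatrix_mulVec_repr, hx]; simp
      have := Matrix.eq_zero_of_mulVec_eq_zero hd h1
      exact b.repr.map_eq_zero_iff.mp (DFunLike.coe_injective this)
    let e : P ≃ₗ[ℤ] LinearMap.range g := LinearEquiv.ofInjective g hinj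
    have := AddSubgroup.index_eq_natAbs_det c (LinearMap.range g).toAddSubgroup (b.map e)
    rw [this, Module.Basis.det_apply]
    congr 2
    ext i j
    rw [Module.Basis.toMatrix_apply, LinearMap.toMatrix_apply, Module.Basis.map_apply]
    rfl

lemma injective_iff_det_ne_zero {P Q : Type*} [AddCommGroup P] [AddCommGroup Q]
    (b : Module.Basis α ℤ P) (c : Module.Basis α ℤ Q) (g : P →ₗ[ℤ] Q) :
    Function.Injective g ↔ (LinearMap.toMatrix b c g).det ≠ 0 := by
  rw [← LinearMap.ker_eq_bot, LinearMap.ker_eq_bot', ← not_iff_not]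
  push Not
  rw [← Matrix.exists_mulVec_eq_zero_iff]
  constructor
  · rintro ⟨x, hx, hx0⟩
    refine ⟨b.repr x, fun h => hx0 (b.repr.map_eq_zero_iff.mp (DFunLike.coe_injective h)), ?_⟩
    rw [LinearMap.toMatrix_mulVec_repr, hx]; simp
  · rintro ⟨v, hv, hv'⟩
    refine ⟨b.equivFun.symm v, ?_, fun h => hv (b.equivFun.symm.map_eq_zero_iff.mp h)⟩
    have h1 := LinearMap.toMatrix_mulVec_repr b c g (b.equivFun.symm v)
    have h2 : ⇑(b.repr (b.equivFun.symm v)) = v := b.equivFun.apply_symm_apply v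
    rw [h2, hv'] at h1
    exact c.repr.map_eq_zero_iff.mp (DFunLike.coe_injective h1.symm)

/-- The cokernel of an injection between lattices of equal rank is finite, hence killed by its
order. -/
lemma exists_smul_mem_range {P Q : Type*} [AddCommGroup P] [AddCommGroup Q]
    (b : Module.Basis α ℤ P) (c : Module.Basis α ℤ Q) (g : P →ₗ[ℤ] Q)
    (hg : Function.Injective g) (y : Q) : ∃ d : ℤ, d ≠ 0 ∧ ∃ x, g x = d • y := by
  have h := AddSubgroup.nsmul_index_mem (LinearMap.range g).toAddSubgroup y
  rw [index_range_eq_natAbs_det b c] at h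
  obtain ⟨x, hx⟩ := h
  refine ⟨((LinearMap.toMatrix b c g).det.natAbs : ℤ), ?_, x, by rw [hx, natCast_zsmul]⟩
  simpa using (injective_iff_det_ne_zero b c g).mp hg

end MatrixLemmas

/-- Shortcut instance. -/
abbrev moduleSections {n : ℕ} (f : Fin (n + 1) → ℤ) (k : ℤ) : Module (R f) (sections f k) :=
  (sections f k).module

/-- Shortcut instance. -/
abbrev mulActionSections {n : ℕ} (f : Fin (n + 1) → ℤ) (k : ℤ) : MulAction (R f) (sections f k) :=
  (moduleSections f k).toMulAction

/-- Shortcut instance. -/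
abbrev smulSections {n : ℕ} (f : Fin (n + 1) → ℤ) (k : ℤ) : SMul (R f) (sections f k) :=
  (moduleSections f k).toSMul

attribute [local instance] moduleSections mulActionSections smulSections

/-! ### Čech cocycles and explicit `ℤ`-bases of `Γ(T_f, 𝒪(k))` -/

section Sections

section Laurent

lemma coeff_T_mul (k m : ℤ) (p : ℤ[T;T⁻¹]) : (T k * p).coeff m = p.coeff (m - k) := by
  have := AddMonoidAlgebra.coeff_single_mul_apply p (1 : ℤ) (k : ℤ) m
  rw [one_mul, neg_add_eq_sub] at this
  exact this

lemma coeff_subInv (v : ℤ[X]) (m : ℤ) : (subInv v).coeff m = (toLaurent v).coeff (-m) :=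
  invert_apply _ _

lemma coeff_toLaurent_natCast (p : ℤ[X]) (i : ℕ) : (toLaurent p).coeff (i : ℤ) = p.coeff i := by
  rw [coeff_toLaurent]
  exact Finsupp.mapDomain_apply Nat.cast_injective _ _

lemma coeff_toLaurent_of_neg (p : ℤ[X]) {m : ℤ} (hm : m < 0) : (toLaurent p).coeff m = 0 := by
  rw [coeff_toLaurent]
  refine Finsupp.mapDomain_of_notMem_range _ _ ?_
  rintro ⟨i, hi⟩
  have hi' : (i : ℤ) = m := hi
  omega

lemma subInv_C_mul_X_pow (a : ℤ) (i : ℕ) :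
    subInv (Polynomial.C a * X ^ i) = LaurentPolynomial.C a * T (-(i : ℤ)) := by
  change LaurentPolynomial.invert (toLaurent _) = _
  rw [toLaurent_C_mul_X_pow, map_mul, invert_C, invert_T]

lemma subInv_C (a : ℤ) : subInv (Polynomial.C a) = LaurentPolynomial.C a := by
  simpa only [pow_zero, mul_one, Nat.cast_zero, neg_zero, T_zero] using subInv_C_mul_X_pow a 0

lemma subInv_X_pow (i : ℕ) : subInv (X ^ i) = T (-(i : ℤ)) := by
  simpa using subInv_C_mul_X_pow 1 i

lemma subInv_X : subInv X = T (-1) := by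
  simpa only [pow_one, Nat.cast_one] using subInv_X_pow 1

end Laurent

variable {n : ℕ} {f : Fin (n + 1) → ℤ}

section Cocycle

/-- The section of `𝒪(k)` on `T_f` with given lifts to the two charts of `ℙ¹`. -/
def mkSection (f : Fin (n + 1) → ℤ) (k : ℤ) (a b : ℤ[X]) (q : ℤ[T;T⁻¹])
    (h : toLaurent a - T k * subInv b = toLaurent (dehom₂ f) * q) : sections f k :=
  ⟨(Ideal.Quotient.mk _ a, Ideal.Quotient.mk _ b), by
    change res₂ f (Ideal.Quotient.mk _ a) =
      Ideal.Quotient.mk _ (T k) * res₁ f (Ideal.Quotient.mk _ b)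
    rw [res₂, res₁, Ideal.quotientMap_mk, Ideal.quotientMap_mk, ← map_mul, Ideal.Quotient.eq,
      Ideal.mem_span_singleton', h]
    exact ⟨q, mul_comm _ _⟩⟩

lemma isCocycle_mkSection (k : ℤ) (a b : ℤ[X]) (q : ℤ[T;T⁻¹])
    (h : toLaurent a - T k * subInv b = toLaurent (dehom₂ f) * q) :
    IsCocycle f k (mkSection f k a b q h) q :=
  ⟨a, b, rfl, rfl, h⟩

/-- Changing the lifts by multiples of the equations changes `q` by a polynomial in `T` and by `T^(k
- n)` times a polynomial in `T⁻¹`. Neither has terms of degree strictly between `k - n` and `0`. -/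
lemma IsCocycle.coeff_eq (hf : f ≠ 0) {k : ℤ} {s : sections f k} {q₁ q₂ : ℤ[T;T⁻¹]}
    (h₁ : IsCocycle f k s q₁) (h₂ : IsCocycle f k s q₂) {m : ℤ} (hm : k - n < m) (hm' : m < 0) :
    q₁.coeff m = q₂.coeff m := by
  obtain ⟨a₁, b₁, ha₁, hb₁, h₁⟩ := h₁
  obtain ⟨a₂, b₂, ha₂, hb₂, h₂⟩ := h₂
  rw [← ha₂, Ideal.Quotient.eq, Ideal.mem_span_singleton'] at ha₁
  rw [← hb₂, Ideal.Quotient.eq, Ideal.mem_span_singleton'] at hb₁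
  obtain ⟨u, hu⟩ := ha₁
  obtain ⟨v, hv⟩ := hb₁
  have hg : toLaurent (dehom₂ f) ≠ 0 := Polynomial.toLaurent_ne_zero.mpr (dehom₂_ne_zero hf)
  have hT : (T k * T (-(n : ℤ)) : ℤ[T;T⁻¹]) = T (k - n) := by
    rw [← T_add, sub_eq_add_neg]
  have e : q₁ - q₂ = toLaurent u - T (k - n) * subInv v := by
    apply mul_left_cancel₀ hg
    have hu' := congrArg toLaurent hu
    have hv' := congrArg subInv hv
    rw [map_mul, map_sub] at hu' hv'
    rw [subInv_dehom₁] at hv'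
    rw [← hT]
    linear_combination h₂ - h₁ - hu' + T k * hv'
  have e' := congrArg (fun p => AddMonoidAlgebra.coeff p m) e
  have e'' : q₁.coeff m - q₂.coeff m =
      (toLaurent u).coeff m - (T (k - n) * subInv v : ℤ[T;T⁻¹]).coeff m := e'
  rw [coeff_T_mul, coeff_subInv, coeff_toLaurent_of_neg _ hm',
    coeff_toLaurent_of_neg _ (by omega), sub_zero] at e''
  exact sub_eq_zero.mp e''

lemma IsCocycle.add {k : ℤ} {s t : sections f k} {q r : ℤ[T;T⁻¹]}
    (h₁ : IsCocycle f k s q) (h₂ : IsCocycle f k t r) : IsCocycle f k (s + t) (q + r) := by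
  obtain ⟨a₁, b₁, ha₁, hb₁, h₁⟩ := h₁
  obtain ⟨a₂, b₂, ha₂, hb₂, h₂⟩ := h₂
  refine ⟨a₁ + a₂, b₁ + b₂, ?_, ?_, ?_⟩
  · rw [map_add, ha₁, ha₂]; rfl
  · rw [map_add, hb₁, hb₂]; rfl
  · rw [map_add, map_add]; linear_combination h₁ + h₂

/-- The coefficient of `T ^ m` in cocycles of sections of `𝒪(k)`, for `k - n < m < 0`. -/
def cocycleCoeff (hf : f ≠ 0) (k m : ℤ) (hm : k - n < m) (hm' : m < 0) : sections f k →ₗ[ℤ] ℤ :=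
  (AddMonoidHom.mk' (fun s => (exists_isCocycle f k s).choose.coeff m) fun s t =>
    IsCocycle.coeff_eq hf (exists_isCocycle f k (s + t)).choose_spec
      ((exists_isCocycle f k s).choose_spec.add (exists_isCocycle f k t).choose_spec)
      hm hm').toIntLinearMap

lemma cocycleCoeff_eq (hf : f ≠ 0) {k m : ℤ} (hm : k - n < m) (hm' : m < 0) {s : sections f k}
    {q : ℤ[T;T⁻¹]} (h : IsCocycle f k s q) : cocycleCoeff hf k m hm hm' s = q.coeff m :=
  IsCocycle.coeff_eq hf (exists_isCocycle f k s).choose_spec h hm hm'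

end Cocycle

section SectionBasis

/-- Lift to the chart `x₂ ≠ 0` of the section of `𝒪(n - μ - 1)` with cocycle `T⁻ʲ`. -/
def upperPart (f : Fin (n + 1) → ℤ) (μ j : ℕ) : ℤ[X] :=
  ∑ i : Fin (n + 1), if (i : ℕ) + j ≤ μ then Polynomial.C (f i) * X ^ (n - i - j) else 0

/-- Lift to the chart `x₁ ≠ 0` of the section of `𝒪(n - μ - 1)` with cocycle `T⁻ʲ`. -/
def lowerPart (f : Fin (n + 1) → ℤ) (μ j : ℕ) : ℤ[X] :=
  -∑ i : Fin (n + 1), if (i : ℕ) + j ≤ μ then 0 else Polynomial.C (f i) * X ^ (i + j - μ - 1)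

lemma toLaurent_dehom₂ : toLaurent (dehom₂ f) =
    ∑ i : Fin (n + 1), LaurentPolynomial.C (f i) * T ((n : ℤ) - i) := by
  rw [dehom₂, map_sum]
  refine Finset.sum_congr rfl fun i _ => ?_
  rw [toLaurent_C_mul_X_pow, Nat.cast_sub (by omega)]

/-- The terms of `F(T, 1) T⁻ʲ` of degree greater than `k` form the first lift, the others are
divisible by `Tᵏ` in the second chart. -/
lemma upperPart_sub_lowerPart {κ μ : ℕ} (hn : κ + μ = n) {k : ℤ} (hk : k + 1 = κ) (j : ℕ) :
    toLaurent (upperPart f μ j) - T k * subInv (lowerPart f μ j) =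
      toLaurent (dehom₂ f) * T (-(j : ℤ)) := by
  rw [toLaurent_dehom₂, upperPart, lowerPart, map_neg, map_sum, map_sum, mul_neg, sub_neg_eq_add,
    Finset.mul_sum, Finset.sum_mul, ← Finset.sum_add_distrib]
  refine Finset.sum_congr rfl fun i _ => ?_
  split_ifs with h
  · rw [toLaurent_C_mul_X_pow, map_zero, mul_zero, add_zero, mul_assoc, ← T_add]
    congr 2
    omega
  · rw [subInv_C_mul_X_pow, map_zero, zero_add, mul_left_comm, mul_assoc, ← T_add, ← T_add]
    congr 2
    omega

lemma monomial_sub_monomial {κ : ℕ} {k : ℤ} (hk : k + 1 = κ) (i : Fin κ) :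
    toLaurent (X ^ (i : ℕ)) - T k * subInv (X ^ (κ - 1 - i : ℕ)) = toLaurent (dehom₂ f) * 0 := by
  rw [toLaurent_X_pow, subInv_X_pow, ← T_add, mul_zero, sub_eq_zero]
  congr 1
  omega

/-- A `ℤ`-basis of `Γ(T_f, 𝒪(κ - 1))`: the monomials of degree `κ - 1`, and sections with
cocycles `T⁻¹, …, T^{-μ}`. -/
def sectionFamily (f : Fin (n + 1) → ℤ) {κ μ : ℕ} (hn : κ + μ = n) {k : ℤ} (hk : k + 1 = κ) :
    Fin κ ⊕ Fin μ → sections f k :=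
  Sum.elim
    (fun i => mkSection f k (X ^ (i : ℕ)) (X ^ (κ - 1 - i : ℕ)) 0
      (monomial_sub_monomial hk i))
    (fun j => mkSection f k (upperPart f μ (j + 1)) (lowerPart f μ (j + 1)) (T (-((j + 1 : ℕ) : ℤ)))
      (upperPart_sub_lowerPart hn hk _))

lemma isCocycle_sectionFamily_inl {κ μ : ℕ} (hn : κ + μ = n) {k : ℤ} (hk : k + 1 = κ)
    (i : Fin κ) : IsCocycle f k (sectionFamily f hn hk (.inl i)) 0 :=
  isCocycle_mkSection _ _ _ _ (monomial_sub_monomial hk i)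

lemma isCocycle_sectionFamily_inr {κ μ : ℕ} (hn : κ + μ = n) {k : ℤ} (hk : k + 1 = κ)
    (j : Fin μ) : IsCocycle f k (sectionFamily f hn hk (.inr j)) (T (-((j + 1 : ℕ) : ℤ))) :=
  isCocycle_mkSection _ _ _ _ (upperPart_sub_lowerPart hn hk _)

/-- This is `H⁰(ℙ¹, 𝒪(k))`: only the degrees from `0` to `k` survive on both charts. -/
lemma eq_sum_of_toLaurent_eq {κ : ℕ} {k : ℤ} (hk : k + 1 = κ) {a b : ℤ[X]}
    (h : toLaurent a = T k * subInv b) :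
    a = ∑ i : Fin κ, Polynomial.C (a.coeff i) * X ^ (i : ℕ) ∧
      b = ∑ i : Fin κ, Polynomial.C (a.coeff i) * X ^ (κ - 1 - i : ℕ) := by
  have hc : ∀ m : ℤ, (toLaurent a).coeff m = (toLaurent b).coeff (k - m) := by
    intro m
    rw [h, coeff_T_mul, coeff_subInv, neg_sub]
  constructor
  · ext l
    simp only [Polynomial.finsetSum_coeff, Polynomial.coeff_C_mul_X_pow]
    by_cases hl : l < κ
    · rw [Finset.sum_eq_single ⟨l, hl⟩]
      · simp
      · intro i _ hi
        rw [if_neg]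
        rintro rfl
        exact hi rfl
      · simp
    · rw [Finset.sum_eq_zero, ← coeff_toLaurent_natCast, hc, coeff_toLaurent_of_neg _ (by omega)]
      intro i _
      rw [if_neg]
      omega
  · ext l
    simp only [Polynomial.finsetSum_coeff, Polynomial.coeff_C_mul_X_pow]
    by_cases hl : l < κ
    · rw [Finset.sum_eq_single ⟨κ - 1 - l, by omega⟩]
      · simp only
        rw [if_pos (by omega), ← coeff_toLaurent_natCast, ← coeff_toLaurent_natCast, hc]
        congr 1
        omega
      · intro i _ hi
        rw [if_neg]
        rintro rfl
        apply hi
        ext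
        simp only
        omega
      · simp
    · rw [Finset.sum_eq_zero, ← coeff_toLaurent_natCast]
      · have := hc (k - l)
        rw [sub_sub_cancel] at this
        rw [← this, coeff_toLaurent_of_neg _ (by omega)]
      intro i _
      rw [if_neg]
      omega

/-- This is `H¹(ℙ¹, 𝒪(k - n))`: as `k - n = -μ - 1`, the degrees that are not coboundaries are `-1,
…, -μ`. -/
lemma exists_laurent_decomposition (n : ℕ) {κ μ : ℕ} (hn : κ + μ = n) {k : ℤ} (hk : k + 1 = κ)
    (q : ℤ[T;T⁻¹]) : ∃ (u v : ℤ[X]) (c : Fin μ → ℤ), q = toLaurent u - T (k - n) * subInv v +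
      ∑ j : Fin μ, LaurentPolynomial.C (c j) * T (-((j + 1 : ℕ) : ℤ)) := by
  induction q using LaurentPolynomial.induction_on' with
  | add p q hp hq =>
    obtain ⟨u, v, c, hp⟩ := hp
    obtain ⟨u', v', c', hq⟩ := hq
    refine ⟨u + u', v + v', c + c', ?_⟩
    rw [hp, hq]
    simp only [map_add, Pi.add_apply, add_mul, Finset.sum_add_distrib]
    ring
  | C_mul_T m a =>
    by_cases h0 : 0 ≤ m
    · refine ⟨Polynomial.C a * X ^ m.toNat, 0, 0, ?_⟩
      rw [toLaurent_C_mul_X_pow, Int.toNat_of_nonneg h0]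
      simp
    by_cases h1 : m ≤ k - n
    · refine ⟨0, -(Polynomial.C a * X ^ (k - n - m).toNat), 0, ?_⟩
      rw [map_neg, subInv_C_mul_X_pow, Int.toNat_of_nonneg (by omega), mul_neg, mul_left_comm,
        ← T_add]
      simp
    · refine ⟨0, 0, fun j => if (j : ℕ) = (-m - 1).toNat then a else 0, ?_⟩
      rw [Finset.sum_eq_single ⟨(-m - 1).toNat, by omega⟩]
      · simp only [map_zero, mul_zero, sub_zero, zero_add, if_true]
        congr 2
        omega
      · intro j _ hj
        have h : (j : ℕ) ≠ (-m - 1).toNat := fun h => hj (Fin.ext h)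
        simp only [if_neg h, map_zero, zero_mul]
      · simp

lemma zsmul_mk (p a : ℤ[X]) (c : ℤ) :
    c • (Ideal.Quotient.mk (Ideal.span {p}) a) =
      Ideal.Quotient.mk (Ideal.span {p}) (Polynomial.C c * a) := by
  rw [← map_zsmul, zsmul_eq_mul]
  simp

lemma val_sum_smul_sectionFamily {κ μ : ℕ} (hn : κ + μ = n) {k : ℤ} (hk : k + 1 = κ)
    (g : Fin κ ⊕ Fin μ → ℤ) :
    (∑ x, g x • sectionFamily f hn hk x).1 =
      (Ideal.Quotient.mk _ (∑ i, Polynomial.C (g (.inl i)) * X ^ (i : ℕ) +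
          ∑ j, Polynomial.C (g (.inr j)) * upperPart f μ (j + 1)),
        Ideal.Quotient.mk _ (∑ i, Polynomial.C (g (.inl i)) * X ^ (κ - 1 - i : ℕ) +
          ∑ j, Polynomial.C (g (.inr j)) * lowerPart f μ (j + 1))) := by
  have h : ∀ (c : ℤ) (s : sections f k), (c • s).1 = c • s.1 := fun _ _ => rfl
  rw [AddSubmonoidClass.coe_finsetSum, Fintype.sum_sum_type]
  simp only [h, sectionFamily, Sum.elim_inl, Sum.elim_inr, mkSection]
  ext
  · simp only [Prod.fst_add, Prod.fst_sum, Prod.smul_fst, zsmul_mk, map_add, map_sum]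
  · simp only [Prod.snd_add, Prod.snd_sum, Prod.smul_snd, zsmul_mk, map_add, map_sum]

lemma linearIndependent_sectionFamily (hf : f ≠ 0) {κ μ : ℕ} (hn : κ + μ = n) {k : ℤ}
    (hk : k + 1 = κ) : LinearIndependent ℤ (sectionFamily f hn hk) := by
  rw [Fintype.linearIndependent_iff]
  intro g hg
  have hr : ∀ j, g (.inr j) = 0 := by
    intro j
    have h := congrArg (cocycleCoeff hf k (-((j + 1 : ℕ) : ℤ)) (by omega) (by omega)) hg
    rw [map_sum, map_zero, Fintype.sum_sum_type] at h
    simp only [map_zsmul, cocycleCoeff_eq hf _ _ (isCocycle_sectionFamily_inl hn hk _),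
      cocycleCoeff_eq hf _ _ (isCocycle_sectionFamily_inr hn hk _), smul_eq_mul] at h
    rw [Finset.sum_eq_zero, zero_add, Finset.sum_eq_single j] at h
    · simpa using h
    · intro i _ hi
      rw [T_apply, if_neg, mul_zero]
      intro h
      apply hi
      ext
      omega
    · simp
    · simp
  have hv := val_sum_smul_sectionFamily (f := f) hn hk g
  rw [hg] at hv
  simp only [hr, map_zero, zero_mul, Finset.sum_const_zero, add_zero] at hv
  have h1 := congrArg Prod.fst hv
  have h2 := congrArg Prod.snd hv
  simp only at h1 h2
  have h1' := Ideal.Quotient.eq_zero_iff_mem.mp h1.symm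
  have h2' := Ideal.Quotient.eq_zero_iff_mem.mp h2.symm
  rw [Ideal.mem_span_singleton'] at h1' h2'
  obtain ⟨u, hu⟩ := h1'
  obtain ⟨v, hv⟩ := h2'
  have hPQ : toLaurent (∑ i, Polynomial.C (g (.inl i)) * X ^ (i : ℕ)) =
      T k * subInv (∑ i, Polynomial.C (g (.inl i)) * X ^ (κ - 1 - i : ℕ)) := by
    rw [map_sum, map_sum, Finset.mul_sum]
    refine Finset.sum_congr rfl fun i _ => ?_
    rw [toLaurent_C_mul_X_pow, subInv_C_mul_X_pow, mul_left_comm, ← T_add]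
    congr 2
    omega
  -- A form of degree `k` vanishing on `T_f` is `f` times a section of `𝒪(k - n)` on `ℙ¹`, which is
  -- zero because `k - n < 0`.
  have hu0 : u = 0 := by
    have hg : toLaurent (dehom₂ f) ≠ 0 := Polynomial.toLaurent_ne_zero.mpr (dehom₂_ne_zero hf)
    have e : toLaurent u = T (k - n) * subInv v := by
      apply mul_left_cancel₀ hg
      rw [← hu, ← hv, map_mul, map_mul, subInv_dehom₁] at hPQ
      rw [sub_eq_add_neg, T_add]
      linear_combination hPQ
    ext l
    rw [← coeff_toLaurent_natCast, e, coeff_T_mul, coeff_subInv, coeff_toLaurent_of_neg]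
    · simp
    · omega
  rw [hu0, zero_mul] at hu
  rintro (i | j)
  · have := congrArg (fun p => Polynomial.coeff p i) hu
    simp only [Polynomial.finsetSum_coeff, Polynomial.coeff_C_mul_X_pow,
      Polynomial.coeff_zero] at this
    rw [Finset.sum_eq_single i] at this
    · simpa using this.symm
    · intro j _ hj
      rw [if_neg]
      intro h
      exact hj (Fin.ext h.symm)
    · simp
  · exact hr j

lemma span_sectionFamily {κ μ : ℕ} (hn : κ + μ = n) {k : ℤ}
    (hk : k + 1 = κ) : ⊤ ≤ Submodule.span ℤ (Set.range (sectionFamily f hn hk)) := by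
  intro s _
  obtain ⟨q, a, b, ha, hb, hq⟩ := exists_isCocycle f k s
  obtain ⟨u, v, c, hc⟩ := exists_laurent_decomposition n hn hk q
  have hsum : ∀ j : Fin μ, toLaurent (dehom₂ f) * (LaurentPolynomial.C (c j) *
      T (-((j + 1 : ℕ) : ℤ))) = toLaurent (Polynomial.C (c j) * upperPart f μ (j + 1)) -
        T k * subInv (Polynomial.C (c j) * lowerPart f μ (j + 1)) := by
    intro j
    rw [map_mul, map_mul, toLaurent_C, subInv_C]
    linear_combination -LaurentPolynomial.C (c j) * upperPart_sub_lowerPart (f := f) hn hk (j + 1)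
  have e : toLaurent (a - u * dehom₂ f - ∑ j, Polynomial.C (c j) * upperPart f μ (j + 1)) =
      T k * subInv (b - v * dehom₁ f - ∑ j, Polynomial.C (c j) * lowerPart f μ (j + 1)) := by
    rw [map_sub, map_sub, map_sub, map_sub, map_mul, map_mul, subInv_dehom₁, map_sum, map_sum]
    rw [hc, mul_add, Finset.mul_sum, Finset.sum_congr rfl fun j _ => hsum j,
      Finset.sum_sub_distrib, ← Finset.mul_sum, sub_eq_add_neg k, T_add] at hq
    linear_combination hq
  obtain ⟨ha', hb'⟩ := eq_sum_of_toLaurent_eq hk e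
  set a' := a - u * dehom₂ f - ∑ j, Polynomial.C (c j) * upperPart f μ (j + 1)
  set b' := b - v * dehom₁ f - ∑ j, Polynomial.C (c j) * lowerPart f μ (j + 1)
  have hs : s = ∑ x, (Sum.elim (fun i : Fin κ => a'.coeff i) c) x • sectionFamily f hn hk x := by
    apply Subtype.ext
    rw [val_sum_smul_sectionFamily]
    simp only [Sum.elim_inl, Sum.elim_inr]
    rw [← ha', ← hb']
    refine Prod.ext ?_ ?_
    · rw [← ha, Ideal.Quotient.eq, Ideal.mem_span_singleton']
      exact ⟨u, by ring⟩
    · rw [← hb, Ideal.Quotient.eq, Ideal.mem_span_singleton']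
      exact ⟨v, by ring⟩
  rw [hs]
  exact Submodule.sum_mem _ fun x _ => Submodule.smul_mem _ _ (Submodule.subset_span ⟨x, rfl⟩)

/-- The basis `sectionFamily`. -/
def sectionBasis (hf : f ≠ 0) {κ μ : ℕ} (hn : κ + μ = n) {k : ℤ} (hk : k + 1 = κ) :
    Module.Basis (Fin κ ⊕ Fin μ) ℤ (sections f k) :=
  Module.Basis.mk (linearIndependent_sectionFamily hf hn hk) (span_sectionFamily hn hk)

lemma sectionBasis_apply (hf : f ≠ 0) {κ μ : ℕ} (hn : κ + μ = n) {k : ℤ} (hk : k + 1 = κ)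
    (x : Fin κ ⊕ Fin μ) : sectionBasis hf hn hk x = sectionFamily f hn hk x :=
  Module.Basis.mk_apply _ _ _

end SectionBasis

end Sections

/-! ### Multiplication by linear forms, and the residue pairing -/

section LinearForms

variable {n : ℕ} {f : Fin (n + 1) → ℤ}

section LinearForm

/-- The linear form `u x₁ + v x₂` on the two charts. -/
def linForm (f : Fin (n + 1) → ℤ) (u v : ℤ) : Chart₂ f × Chart₁ f :=
  (Ideal.Quotient.mk _ (Polynomial.C u * X + Polynomial.C v),
    Ideal.Quotient.mk _ (Polynomial.C u + Polynomial.C v * X))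

lemma linForm_eq (u v : ℤ) :
    linForm f u v = u • linForm f 1 0 + v • linForm f 0 1 := by
  ext <;> simp [linForm]

lemma linForm_mul_mem {k l : ℤ} (h : l = k + 1) (u v : ℤ) {s : Chart₂ f × Chart₁ f}
    (hs : s ∈ sections f k) : linForm f u v * s ∈ sections f l := by
  have hs' : res₂ f s.1 = Ideal.Quotient.mk _ (T k) * res₁ f s.2 := hs
  have e : res₂ f (linForm f u v).1 = Ideal.Quotient.mk _ (T 1) * res₁ f (linForm f u v).2 := by
    rw [linForm, res₂, res₁, Ideal.quotientMap_mk, Ideal.quotientMap_mk, ← map_mul]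
    congr 1
    rw [map_add, map_add, map_mul, map_mul, toLaurent_C, toLaurent_C, toLaurent_X, subInv_C,
      subInv_C, subInv_X, mul_add, mul_left_comm, ← T_add]
    simp [mul_comm]
  change res₂ f ((linForm f u v).1 * s.1) =
    Ideal.Quotient.mk _ (T l) * res₁ f ((linForm f u v).2 * s.2)
  rw [map_mul, map_mul, hs', e, h, T_add, map_mul]
  ring

/-- Multiplication by the linear form `u x₁ + v x₂` on sections. -/
def mulForm (f : Fin (n + 1) → ℤ) {k l : ℤ} (h : l = k + 1) (u v : ℤ) :
    sections f k →ₗ[R f] sections f l where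
  toFun s := ⟨linForm f u v * s.1, linForm_mul_mem h u v s.2⟩
  map_add' _ _ := Subtype.ext (mul_add _ _ _)
  map_smul' r s := Subtype.ext (mul_left_comm (linForm f u v) r.1 s.1)

lemma IsCocycle.mulForm {k l : ℤ} (h : l = k + 1) (u v : ℤ) {s : sections f k} {q : ℤ[T;T⁻¹]}
    (hs : IsCocycle f k s q) : IsCocycle f l (mulForm f h u v s)
      (LaurentPolynomial.C u * (T 1 * q) + LaurentPolynomial.C v * q) := by
  obtain ⟨a, b, ha, hb, hq⟩ := hs
  refine ⟨(Polynomial.C u * X + Polynomial.C v) * a, (Polynomial.C u + Polynomial.C v * X) * b,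
    ?_, ?_, ?_⟩
  · rw [map_mul, ha]; rfl
  · rw [map_mul, hb]; rfl
  · have hT : (T 1 * T (-1) : ℤ[T;T⁻¹]) = 1 := by rw [← T_add]; simp
    rw [map_mul, map_mul, map_add, map_add, map_mul, map_mul, toLaurent_C, toLaurent_C, toLaurent_X,
      subInv_C, subInv_C, subInv_X, h, T_add]
    linear_combination (LaurentPolynomial.C u * T 1 + LaurentPolynomial.C v) * hq -
      T k * LaurentPolynomial.C v * subInv b * hT

/-- The map `J_f → H¹(ℙ¹, 𝒪(-2)) = ℤ`. -/
def residue (hf : f ≠ 0) : J f →ₗ[ℤ] ℤ :=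
  cocycleCoeff hf ((n : ℤ) - 2) (-1) (by omega) (by omega)

lemma residue_eq (hf : f ≠ 0) {s : J f} {q : ℤ[T;T⁻¹]} (h : IsCocycle f _ s q) :
    residue hf s = q.coeff (-1) :=
  cocycleCoeff_eq hf _ _ h

/-- Multiplication by `u x₁ + v x₂`, from `I_f` to `J_f`. -/
abbrev mulIJ (f : Fin (n + 1) → ℤ) (u v : ℤ) : I f →ₗ[R f] J f :=
  mulForm f (by ring) u v

lemma coeff_C_mul (a m : ℤ) (q : ℤ[T;T⁻¹]) :
    (LaurentPolynomial.C a * q).coeff m = a * q.coeff m := by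
  rw [← LaurentPolynomial.smul_eq_C_mul]
  rfl

/-- Multiplication by the linear form takes a cocycle `q` to `(u T + v) q`, so the residue combines
the coefficients at `T⁻²` and `T⁻¹`. The sign in the second coordinate of `V` accounts for the
minus. -/
lemma residue_mulIJ (hf : f ≠ 0) (u v : ℤ) (s : I f) :
    residue hf (mulIJ f u v s) = v * toV f s 0 - u * toV f s 1 := by
  obtain ⟨q, hq⟩ := exists_isCocycle f _ s
  rw [toV_eq hf s hq, residue_eq hf (hq.mulForm (by ring) u v)]
  change (LaurentPolynomial.C u * (T 1 * q)).coeff (-1) +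
    (LaurentPolynomial.C v * q).coeff (-1) = _
  rw [coeff_C_mul, coeff_C_mul, coeff_T_mul]
  simp
  ring

end LinearForm

section Functions

/-- Global functions as sections of `𝒪(0)`. -/
def functionsEquiv (f : Fin (n + 1) → ℤ) : R f ≃ₗ[R f] sections f 0 where
  toFun r := ⟨r.1, by
    have hr : res₂ f r.1.1 = res₁ f r.1.2 := r.2
    change res₂ f r.1.1 = Ideal.Quotient.mk _ (T 0) * res₁ f r.1.2
    rw [hr, T_zero, map_one, one_mul]⟩
  invFun s := ⟨s.1, by
    have hs : res₂ f s.1.1 = Ideal.Quotient.mk _ (T 0) * res₁ f s.1.2 := s.2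
    rw [T_zero, map_one, one_mul] at hs
    exact hs⟩
  map_add' _ _ := rfl
  map_smul' _ _ := rfl
  left_inv _ := rfl
  right_inv _ := rfl

/-- A monomial is a section on all of `ℙ¹`, so multiplying by it does not enlarge the cocycle beyond
a shift. -/
lemma isCocycle_smul_monomial {κ μ : ℕ} (hn : κ + μ = n) {k : ℤ} (hk : k + 1 = κ) (i : Fin κ)
    {r : R f} {q : ℤ[T;T⁻¹]} (hr : IsCocycle f 0 (functionsEquiv f r) q) :
    IsCocycle f k (r • sectionFamily f hn hk (.inl i)) (T i * q) := by
  obtain ⟨a, b, ha, hb, hq⟩ := hr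
  refine ⟨a * X ^ (i : ℕ), b * X ^ (κ - 1 - i : ℕ), ?_, ?_, ?_⟩
  · rw [map_mul, ha]; rfl
  · rw [map_mul, hb]; rfl
  · rw [T_zero, one_mul] at hq
    have hT : (T k * T (-((κ - 1 - i : ℕ) : ℤ)) : ℤ[T;T⁻¹]) = T i := by
      rw [← T_add]; congr 1; omega
    rw [map_mul, map_mul, toLaurent_X_pow, subInv_X_pow]
    linear_combination T i * hq - subInv b * hT

end Functions

section Bases

variable {m : ℕ} {f : Fin (m + 2 + 1) → ℤ}

/-- `Fin m ⊕ Fin 2 ≃ Fin (m + 1) ⊕ Fin 1`, preserving the order. -/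
def shiftEquiv (m : ℕ) : Fin m ⊕ Fin 2 ≃ Fin (m + 1) ⊕ Fin 1 :=
  (finSumFinEquiv : Fin m ⊕ Fin 2 ≃ Fin (m + 2)).trans
    (finSumFinEquiv : Fin (m + 1) ⊕ Fin 1 ≃ Fin (m + 1 + 1)).symm

lemma shiftEquiv_inl (i : Fin m) : shiftEquiv m (.inl i) = .inl i.castSucc := by
  rw [shiftEquiv, Equiv.trans_apply, Equiv.symm_apply_eq]
  ext
  simp

lemma shiftEquiv_inr_zero : shiftEquiv m (.inr 0) = .inl (Fin.last m) := by
  rw [shiftEquiv, Equiv.trans_apply, Equiv.symm_apply_eq]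
  ext
  simp

lemma shiftEquiv_inr_one : shiftEquiv m (.inr 1) = .inr 0 := by
  rw [shiftEquiv, Equiv.trans_apply, Equiv.symm_apply_eq]
  ext
  simp

/-- The basis `T⁰, …, Tᵐ⁻¹` and sections with cocycles `T⁻¹, T⁻²` of `I_f`. -/
def basisI (hf : f ≠ 0) : Module.Basis (Fin m ⊕ Fin 2) ℤ (I f) :=
  sectionBasis hf (κ := m) (μ := 2) rfl (by push_cast; ring)

/-- The basis `T⁰, …, Tᵐ` and a section with cocycle `T⁻¹` of `J_f`. -/
def basisJ (hf : f ≠ 0) : Module.Basis (Fin (m + 1) ⊕ Fin 1) ℤ (J f) :=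
  sectionBasis hf (κ := m + 1) (μ := 1) rfl (by push_cast; ring)

/-- The basis of `R_f` of functions with cocycles `T⁻¹, …, T^{-(m+1)}`, and `1`. -/
def basisR (hf : f ≠ 0) : Module.Basis (Fin (m + 1) ⊕ Fin 1) ℤ (R f) :=
  ((sectionBasis hf (κ := 1) (μ := m + 1) (by ring) (by simp)).map
    (functionsEquiv f).toAddEquiv.toIntLinearEquiv.symm).reindex (Equiv.sumComm _ _)

lemma functionsEquiv_basisR (hf : f ≠ 0) (x : Fin (m + 1) ⊕ Fin 1) :
    functionsEquiv f (basisR hf x) =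
      sectionFamily f (κ := 1) (μ := m + 1) (by ring) (by simp) x.swap := by
  rw [basisR, Module.Basis.reindex_apply, Module.Basis.map_apply, sectionBasis_apply]
  exact (functionsEquiv f).apply_symm_apply _

/-- The matrix is block unitriangular: `T⁻ʲ⁻¹ Tⁱ` has residue `δᵢⱼ`, while the function `1` pairs to
`0` with monomials and to `1` with the section of cocycle `T⁻¹`. This is what makes the duality
perfect over `ℤ`. -/
lemma det_residue_basis (hf : f ≠ 0) :
    (Matrix.of fun x y => residue hf (basisR hf x • basisJ hf y)).det = 1 := by
  set P : Matrix (Fin (m + 1) ⊕ Fin 1) (Fin (m + 1) ⊕ Fin 1) ℤ :=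
    Matrix.of fun x y => residue hf (basisR hf x • basisJ hf y) with hP
  have h11 : P.toBlocks₁₁ = 1 := by
    ext j i
    have hc : IsCocycle f 0 (functionsEquiv f (basisR hf (.inl j))) (T (-((j + 1 : ℕ) : ℤ))) := by
      rw [functionsEquiv_basisR]
      exact isCocycle_sectionFamily_inr _ _ _
    simp only [Matrix.toBlocks₁₁, hP, Matrix.of_apply]
    rw [basisJ, sectionBasis_apply, residue_eq hf (isCocycle_smul_monomial _ _ i hc), ← T_add,
      T_apply, Matrix.one_apply]
    congr 1
    rw [eq_iff_iff, Fin.ext_iff]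
    omega
  have h21 : P.toBlocks₂₁ = 0 := by
    ext j i
    have hc : IsCocycle f 0 (functionsEquiv f (basisR hf (.inr j))) 0 := by
      rw [functionsEquiv_basisR]
      exact isCocycle_sectionFamily_inl _ _ _
    simp only [Matrix.toBlocks₂₁, hP, Matrix.of_apply]
    rw [basisJ, sectionBasis_apply, residue_eq hf (isCocycle_smul_monomial _ _ i hc)]
    simp
  have h22 : P.toBlocks₂₂ = 1 := by
    ext j i
    have h1 : basisR hf (.inr j) = 1 := by
      apply (functionsEquiv f).injective
      rw [functionsEquiv_basisR]
      apply Subtype.ext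
      ext <;> simp [sectionFamily, mkSection, functionsEquiv]
    simp only [Matrix.toBlocks₂₂, hP, Matrix.of_apply]
    rw [h1, one_smul, basisJ, sectionBasis_apply,
      residue_eq hf (isCocycle_sectionFamily_inr _ _ _), T_apply, Matrix.one_apply,
      if_pos (show -((i + 1 : ℕ) : ℤ) = -1 by omega), if_pos (Subsingleton.elim j i)]
  rw [← P.fromBlocks_toBlocks, h11, h21, h22, Matrix.det_fromBlocks_zero₂₁, Matrix.det_one,
    Matrix.det_one, one_mul]

end Bases

end LinearForms

/-! ### The form of the canonical pair `(I_f, R_f)` -/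

section CanonicalPair

variable {m : ℕ} {f : Fin (m + 2 + 1) → ℤ}

section FormMatrix

variable {S : Type*} [CommRing S]

/-- The matrix of multiplication by `u x₁ + v x₂` from `I_f` to `J_f`, for a form with
coefficients `g`. -/
def formMatrix (g : Fin (m + 2 + 1) → S) (u v : S) :
    Matrix (Fin (m + 1) ⊕ Fin 1) (Fin m ⊕ Fin 2) S :=
  Matrix.fromBlocks
    (Matrix.of fun l i => (if l = i.succ then u else 0) + if l = i.castSucc then v else 0)
    (Matrix.of fun l => ![-(u * g l.rev.succ.succ) + if l = Fin.last m then v * g 1 else 0,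
      if l = Fin.last m then v * g 0 else 0])
    0 (Matrix.of fun _ => ![v, u])

/-- The form `-z x₁ + y x₂` vanishes at `T = y / z`. Adding the monomial rows with the weights `yˡ
zᵐ⁻ˡ` therefore clears the monomial columns, at the cost of a factor `yᵐ`. What remains is block
triangular: a triangular block of determinant `yᵐ` and a `2 × 2` block that contains the form. -/
lemma det_formMatrix [IsDomain S] (g : Fin (m + 2 + 1) → S) {y z : S} (hy : y ≠ 0) :
    ((formMatrix g (-z) y).submatrix (shiftEquiv m) id).det =
      -∑ i : Fin (m + 2 + 1), g i * y ^ (m + 2 - (i : ℕ)) * z ^ (i : ℕ) := by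
  set D := (formMatrix g (-z) y).submatrix (shiftEquiv m) id with hD
  let c' : Fin (m + 1) ⊕ Fin 1 → S := Sum.elim (fun l => y ^ (l : ℕ) * z ^ (m - l : ℕ)) 0
  set D' := D.updateRow (.inr 0) (∑ k, c' (shiftEquiv m k) • D k) with hD'
  have hdet : D'.det = y ^ m * D.det := by
    rw [hD', Matrix.det_updateRow_sum D (.inr 0) (fun k => c' (shiftEquiv m k)),
      shiftEquiv_inr_zero]
    simp [c']
  have hrow : ∀ x, D' (.inr 0) x =
      ∑ l : Fin (m + 1), y ^ (l : ℕ) * z ^ (m - l : ℕ) * formMatrix g (-z) y (.inl l) x := by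
    intro x
    rw [hD', Matrix.updateRow_self, Finset.sum_apply]
    have := Equiv.sum_comp (shiftEquiv m) fun k => c' k * formMatrix g (-z) y k x
    rw [Fintype.sum_sum_type] at this
    simpa [c', hD] using this
  have h10 : ∀ x, D' (.inr 1) x = formMatrix g (-z) y (.inr 0) x := by
    intro x
    rw [hD', Matrix.updateRow_ne (by simp), hD, Matrix.submatrix_apply, shiftEquiv_inr_one, id]
  have h21 : D'.toBlocks₂₁ = 0 := by
    ext r i
    fin_cases r
    · change D' (.inr 0) (.inl i) = 0
      rw [hrow]
      simp only [formMatrix, Matrix.fromBlocks_apply₁₁, Matrix.of_apply, mul_add, mul_ite, mul_zero,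
        Finset.sum_add_distrib, Finset.sum_ite_eq', Finset.mem_univ, if_true, Fin.val_succ,
        Fin.val_castSucc]
      rw [show m - (i : ℕ) = m - (i + 1) + 1 by omega]
      ring
    · change D' (.inr 1) (.inl i) = 0
      rw [h10]
      rfl
  have h11 : D'.toBlocks₁₁.det = y ^ m := by
    have e : ∀ l i, D'.toBlocks₁₁ l i =
        (if l.castSucc = i.succ then -z else 0) + if l = i then y else 0 := by
      intro l i
      change D' (.inl l) (.inl i) = _
      rw [hD', Matrix.updateRow_ne (by simp), hD, Matrix.submatrix_apply, shiftEquiv_inl, id]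
      simp [formMatrix]
    rw [Matrix.det_of_isLowerTriangular]
    · simp only [e]
      rw [Finset.prod_congr rfl fun i _ => ?_, Finset.prod_const, Finset.card_univ,
        Fintype.card_fin]
      rw [if_neg, zero_add, if_pos trivial]
      rw [Fin.ext_iff]
      simp
    · intro l i hli
      have hli' : l < i := hli
      rw [e, if_neg, if_neg hli'.ne, add_zero]
      rw [Fin.ext_iff]
      simp only [Fin.val_castSucc, Fin.val_succ]
      have : (l : ℕ) < i := hli'
      omega
  have h22 : D'.toBlocks₂₂.det =
      -∑ i : Fin (m + 2 + 1), g i * y ^ (m + 2 - (i : ℕ)) * z ^ (i : ℕ) := by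
    have e00 : D' (.inr 0) (.inr 0) =
        z * ∑ i : Fin (m + 1), g i.succ.succ * y ^ (m - i : ℕ) * z ^ (i : ℕ) +
          y ^ (m + 1) * g 1 := by
      rw [hrow, Finset.mul_sum, ← Equiv.sum_comp Fin.revPerm (fun i : Fin (m + 1) =>
        z * (g i.succ.succ * y ^ (m - i : ℕ) * z ^ (i : ℕ)))]
      simp only [formMatrix, Matrix.fromBlocks_apply₁₂, Matrix.of_apply, Matrix.cons_val_zero,
        mul_add, mul_ite, mul_zero, Finset.sum_add_distrib, Finset.sum_ite_eq', Finset.mem_univ,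
        if_true, Fin.val_last, Fin.revPerm_apply]
      congr 1
      · refine Finset.sum_congr rfl fun l _ => ?_
        rw [show ((Fin.rev l : Fin (m + 1)) : ℕ) = m - l by rw [Fin.val_rev]; omega,
          show m - (m - (l : ℕ)) = l by omega]
        ring
      · simp
        ring
    have e01 : D' (.inr 0) (.inr 1) = y ^ (m + 1) * g 0 := by
      rw [hrow]
      simp only [formMatrix, Matrix.fromBlocks_apply₁₂, Matrix.of_apply, Matrix.cons_val_one]
      simp
      ring
    rw [Matrix.det_fin_two]
    change D' (.inr 0) (.inr 0) * D' (.inr 1) (.inr 1) -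
      D' (.inr 0) (.inr 1) * D' (.inr 1) (.inr 0) = _
    have e : ∑ i : Fin (m + 2 + 1), g i * y ^ (m + 2 - (i : ℕ)) * z ^ (i : ℕ) =
        g 0 * y ^ (m + 2) + g 1 * y ^ (m + 1) * z +
          z * (z * ∑ i : Fin (m + 1), g i.succ.succ * y ^ (m - i : ℕ) * z ^ (i : ℕ)) := by
      rw [Fin.sum_univ_succ, Fin.sum_univ_succ, ← add_assoc, Finset.mul_sum, Finset.mul_sum]
      congr 1
      · simp
      refine Finset.sum_congr rfl fun i _ => ?_
      simp only [Fin.val_succ]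
      rw [show m + 2 - ((i : ℕ) + 1 + 1) = m - i by omega]
      ring
    rw [e00, e01, h10, h10, e]
    simp [formMatrix]
    ring
  have key : y ^ m * D.det =
      y ^ m * -∑ i : Fin (m + 2 + 1), g i * y ^ (m + 2 - (i : ℕ)) * z ^ (i : ℕ) := by
    rw [← hdet, ← D'.fromBlocks_toBlocks, h21, Matrix.det_fromBlocks_zero₂₁, h11, h22]
  exact mul_left_cancel₀ (pow_ne_zero m hy) key

end FormMatrix

section MulMatrix

lemma dehom₂_eq : dehom₂ f = Polynomial.C (f 0) * X ^ (m + 2) + Polynomial.C (f 1) * X ^ (m + 1) +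
    ∑ i : Fin (m + 1), Polynomial.C (f i.succ.succ) * X ^ (m - i : ℕ) := by
  rw [dehom₂, Fin.sum_univ_succ, Fin.sum_univ_succ, ← add_assoc]
  congr 1
  refine Finset.sum_congr rfl fun i _ => ?_
  simp only [Fin.val_succ]
  rw [show m + 2 - ((i : ℕ) + 1 + 1) = m - i by omega]

lemma dehom₁_eq : dehom₁ f = Polynomial.C (f 0) + X * (Polynomial.C (f 1) +
    X * ∑ i : Fin (m + 1), Polynomial.C (f i.succ.succ) * X ^ (i : ℕ)) := by
  rw [dehom₁, Fin.sum_univ_succ, Fin.sum_univ_succ, Finset.mul_sum, mul_add, Finset.mul_sum]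
  refine congrArg₂ (· + ·) (by simp) (congrArg₂ (· + ·) (by simp [mul_comm]) ?_)
  refine Finset.sum_congr rfl fun i _ => ?_
  simp only [Fin.val_succ]
  ring

lemma upperPart_one_one : upperPart f 1 1 = Polynomial.C (f 0) * X ^ (m + 1) := by
  rw [upperPart, Fin.sum_univ_succ]
  simp

lemma upperPart_two_one : upperPart f 2 1 =
    Polynomial.C (f 0) * X ^ (m + 1) + Polynomial.C (f 1) * X ^ m := by
  rw [upperPart, Fin.sum_univ_succ, Fin.sum_univ_succ]
  simp

lemma upperPart_two_two : upperPart f 2 2 = Polynomial.C (f 0) * X ^ m := by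
  rw [upperPart, Fin.sum_univ_succ]
  simp

lemma lowerPart_one_one : lowerPart f 1 1 = -(Polynomial.C (f 1) +
    X * ∑ i : Fin (m + 1), Polynomial.C (f i.succ.succ) * X ^ (i : ℕ)) := by
  rw [lowerPart, Fin.sum_univ_succ, Fin.sum_univ_succ, Finset.mul_sum]
  simp [pow_succ]
  refine Finset.sum_congr rfl fun i _ => by ring

lemma lowerPart_two_one : lowerPart f 2 1 =
    -∑ i : Fin (m + 1), Polynomial.C (f i.succ.succ) * X ^ (i : ℕ) := by
  rw [lowerPart, Fin.sum_univ_succ, Fin.sum_univ_succ]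
  simp

lemma lowerPart_two_two : lowerPart f 2 2 = -(Polynomial.C (f 1) +
    X * ∑ i : Fin (m + 1), Polynomial.C (f i.succ.succ) * X ^ (i : ℕ)) := by
  rw [lowerPart, Fin.sum_univ_succ, Fin.sum_univ_succ, Finset.mul_sum]
  simp [pow_succ]
  refine Finset.sum_congr rfl fun i _ => by ring

lemma mulIJ_basisI (hf : f ≠ 0) (u v : ℤ) (x : Fin m ⊕ Fin 2) :
    mulIJ f u v (basisI hf x) = ∑ y, formMatrix f u v y x • basisJ hf y := by
  simp only [basisI, basisJ, sectionBasis_apply]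
  apply Subtype.ext
  rw [val_sum_smul_sectionFamily]
  rcases x with i | j
  · refine Prod.ext ?_ ?_
    · change Ideal.Quotient.mk _ ((Polynomial.C u * X + Polynomial.C v) * X ^ (i : ℕ)) = _
      congr 1
      simp [-eq_intCast, formMatrix, add_mul, Finset.sum_add_distrib, apply_ite Polynomial.C]
      ring
    · change Ideal.Quotient.mk _ ((Polynomial.C u + Polynomial.C v * X) * X ^ (m - 1 - i : ℕ)) = _
      congr 1
      simp [-eq_intCast, formMatrix, add_mul, Finset.sum_add_distrib, apply_ite Polynomial.C]
      rw [show m - (i + 1 : ℕ) = m - 1 - i by omega, show m - (i : ℕ) = m - 1 - i + 1 by omega]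
      ring
  have h₂ : ∑ l : Fin (m + 1), Polynomial.C (f l.rev.succ.succ) * X ^ (l : ℕ) =
      ∑ i : Fin (m + 1), Polynomial.C (f i.succ.succ) * X ^ (m - i : ℕ) := by
    rw [← Equiv.sum_comp Fin.revPerm]
    refine Finset.sum_congr rfl fun l _ => ?_
    rw [Fin.revPerm_apply, Fin.rev_rev, Fin.val_rev]
    congr 2
    omega
  have h₁ : ∑ l : Fin (m + 1), Polynomial.C (f l.rev.succ.succ) * X ^ (m + 1 - 1 - l : ℕ) =
      ∑ i : Fin (m + 1), Polynomial.C (f i.succ.succ) * X ^ (i : ℕ) := by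
    rw [← Equiv.sum_comp Fin.revPerm]
    refine Finset.sum_congr rfl fun l _ => ?_
    rw [Fin.revPerm_apply, Fin.rev_rev, Fin.val_rev]
    congr 2
    omega
  fin_cases j
  · refine Prod.ext ?_ ?_
    · change Ideal.Quotient.mk _ ((Polynomial.C u * X + Polynomial.C v) * upperPart f 2 1) = _
      rw [Ideal.Quotient.eq, Ideal.mem_span_singleton']
      -- The product has cocycle `u + v T⁻¹`, whose constant term is a coboundary: it is absorbed by
      -- `u F(T, 1)` on this chart.
      refine ⟨Polynomial.C u, ?_⟩
      simp [-eq_intCast, formMatrix, add_mul, Finset.sum_add_distrib, apply_ite Polynomial.C,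
        upperPart_two_one, upperPart_one_one, dehom₂_eq, mul_assoc, ← Finset.mul_sum, h₂]
      ring
    · change Ideal.Quotient.mk _ ((Polynomial.C u + Polynomial.C v * X) * lowerPart f 2 1) = _
      congr 1
      have h₁' := h₁
      simp only [Nat.add_sub_cancel] at h₁'
      simp [-eq_intCast, formMatrix, add_mul, Finset.sum_add_distrib, apply_ite Polynomial.C,
        lowerPart_two_one, lowerPart_one_one, mul_assoc, ← Finset.mul_sum, h₁']
      ring
  · refine Prod.ext ?_ ?_
    · change Ideal.Quotient.mk _ ((Polynomial.C u * X + Polynomial.C v) * upperPart f 2 2) = _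
      congr 1
      simp [-eq_intCast, formMatrix, apply_ite Polynomial.C, upperPart_two_two, upperPart_one_one]
      ring
    · change Ideal.Quotient.mk _ ((Polynomial.C u + Polynomial.C v * X) * lowerPart f 2 2) = _
      rw [Ideal.Quotient.eq, Ideal.mem_span_singleton']
      -- The product has cocycle `u T⁻¹ + v T⁻²`, and `T⁻²` is a coboundary for `J_f`, absorbed on
      -- this chart.
      refine ⟨-Polynomial.C v, ?_⟩
      simp [-eq_intCast, formMatrix, apply_ite Polynomial.C, lowerPart_two_two,
        lowerPart_one_one, dehom₁_eq]
      ring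

lemma residue_smul_mulIJ (hf : f ≠ 0) (u v : ℤ) (x : Fin (m + 1) ⊕ Fin 1) (z : Fin m ⊕ Fin 2) :
    residue hf (mulIJ f u v (basisR hf x • basisI hf z)) =
      ((Matrix.of fun x y => residue hf (basisR hf x • basisJ hf y)) * formMatrix f u v) x z := by
  have h : basisR hf x • (∑ y, formMatrix f u v y z • basisJ hf y) =
      ∑ y, formMatrix f u v y z • (basisR hf x • basisJ hf y) := by
    rw [Finset.smul_sum]
    refine Finset.sum_congr rfl fun y _ => ?_
    exact smul_comm _ _ _
  rw [map_smul, mulIJ_basisI, h, map_sum, Matrix.mul_apply]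
  refine Finset.sum_congr rfl fun y _ => ?_
  rw [map_zsmul, smul_eq_mul, mul_comm]
  rfl

/-- The order preserving equivalence. -/
def succSumEquiv (m : ℕ) : Fin (m + 1) ⊕ Fin 1 ≃ Fin (m + 2) :=
  (finSumFinEquiv : Fin (m + 1) ⊕ Fin 1 ≃ Fin (m + 1 + 1))

/-- `basisI`, indexed by `Fin n`. -/
def finBasisI (hf : f ≠ 0) : Module.Basis (Fin (m + 2)) ℤ (I f) :=
  (basisI hf).reindex finSumFinEquiv

/-- `basisJ`, indexed by `Fin n`. -/
def finBasisJ (hf : f ≠ 0) : Module.Basis (Fin (m + 2)) ℤ (J f) :=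
  (basisJ hf).reindex (succSumEquiv m)

/-- `basisR`, indexed by `Fin n`. -/
def finBasisR (hf : f ≠ 0) : Module.Basis (Fin (m + 2)) ℤ (R f) :=
  (basisR hf).reindex (succSumEquiv m)

lemma det_residue_finBasis (hf : f ≠ 0) :
    (Matrix.of fun x y => residue hf (finBasisR hf x • finBasisJ hf y)).det = 1 := by
  rw [← det_residue_basis hf, ← Matrix.det_submatrix_equiv_self (succSumEquiv m)]
  congr 1
  ext x y
  simp [finBasisR, finBasisJ]

/-- The multiplication `I_f ⊗ R_f → I_f` is balanced for `f`. -/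
lemma detForm_canonical (hf : f ≠ 0) :
    detForm (fun i => Matrix.of fun j k => toV f (finBasisR hf k • finBasisI hf j) i) =
      -toMvPolynomial f := by
  let g : Fin (m + 2 + 1) → MvPolynomial (Fin 2) ℤ := fun i => MvPolynomial.C (f i)
  let P := Matrix.of fun x y => residue hf (basisR hf x • basisJ hf y)
  let e : Fin (m + 2) ≃ Fin m ⊕ Fin 2 := finSumFinEquiv.symm
  let e' : Fin (m + 2) ≃ Fin (m + 1) ⊕ Fin 1 := (succSumEquiv m).symm
  -- The forms `x₂` and `-x₁` recover the two coordinates of `V` as residues.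
  have hT : ∀ i x z, toV f (basisR hf x • basisI hf z) i =
      (P * formMatrix f (![0, -1] i) (![1, 0] i)) x z := by
    intro i x z
    rw [← residue_smul_mulIJ, residue_mulIJ]
    fin_cases i <;> simp
  have hM : (MvPolynomial.X 0 : MvPolynomial (Fin 2) ℤ) • (formMatrix f 0 1).map MvPolynomial.C +
      (MvPolynomial.X 1 : MvPolynomial (Fin 2) ℤ) • (formMatrix f (-1) 0).map MvPolynomial.C =
        formMatrix g (-MvPolynomial.X 1) (MvPolynomial.X 0) := by
    ext1 y z
    rcases y with l | l <;> rcases z with i | i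
    · simp [formMatrix, apply_ite MvPolynomial.C]
      ring
    · fin_cases i <;> simp [formMatrix, apply_ite MvPolynomial.C, g, add_comm]
    · simp [formMatrix]
    · fin_cases i <;> simp [formMatrix]
  have hdet : (MvPolynomial.X 0 : MvPolynomial (Fin 2) ℤ) •
      (Matrix.of fun j k => toV f (finBasisR hf k • finBasisI hf j) 0).map MvPolynomial.C +
      (MvPolynomial.X 1 : MvPolynomial (Fin 2) ℤ) •
      (Matrix.of fun j k => toV f (finBasisR hf k • finBasisI hf j) 1).map MvPolynomial.C =
      ((P.map MvPolynomial.C).submatrix e' e' * ((formMatrix g (-MvPolynomial.X 1)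
        (MvPolynomial.X 0)).submatrix (shiftEquiv m) id).submatrix e e).transpose := by
    rw [← hM]
    have hs : ∀ A : Matrix (Fin (m + 1) ⊕ Fin 1) (Fin m ⊕ Fin 2) (MvPolynomial (Fin 2) ℤ),
        (A.submatrix (shiftEquiv m) id).submatrix e e = A.submatrix e' e := by
      intro A
      rw [Matrix.submatrix_submatrix]
      congr 1
      ext1 x
      simp [e, e', shiftEquiv, succSumEquiv]
    rw [hs, Matrix.submatrix_mul_equiv, Matrix.mul_add, Matrix.mul_smul, Matrix.mul_smul,
      ← Matrix.map_mul, ← Matrix.map_mul]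
    ext1 j k
    simp [finBasisR, finBasisI, hT, e, e', -Matrix.map_mul]
  rw [detForm, hdet, Matrix.det_transpose, Matrix.det_mul, Matrix.det_submatrix_equiv_self,
    Matrix.det_submatrix_equiv_self, det_formMatrix _ (MvPolynomial.X_ne_zero 0)]
  have hP : (P.map MvPolynomial.C).det = (1 : MvPolynomial (Fin 2) ℤ) := by
    change (MvPolynomial.C.mapMatrix P).det = _
    rw [← RingHom.map_det, det_residue_basis hf, map_one]
  rw [hP, one_mul, toMvPolynomial]

end MulMatrix

end CanonicalPair

/-! ### The determinant form as a determinant times a homogenized characteristic polynomial -/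

section DetForm

variable {n : ℕ}

/-- `det ((x₁ - t x₂) Z - d x₂)`. -/
def homogCharpoly (t d : ℤ) (Z : Matrix (Fin n) (Fin n) ℤ) : MvPolynomial (Fin 2) ℤ :=
  ((MvPolynomial.X 0 - MvPolynomial.C t * MvPolynomial.X 1 : MvPolynomial (Fin 2) ℤ) •
    Z.map (Int.castRingHom (MvPolynomial (Fin 2) ℤ)) -
      (MvPolynomial.C d * MvPolynomial.X 1 : MvPolynomial (Fin 2) ℤ) • 1).det

lemma aeval_homogCharpoly {S : Type*} [CommRing S] [Algebra ℤ S] (x y : S) (t d : ℤ)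
    (Z : Matrix (Fin n) (Fin n) ℤ) : MvPolynomial.aeval ![x, y] (homogCharpoly t d Z) =
      ((x - t * y) • Z.map (Int.castRingHom S) - (d * y) • (1 : Matrix (Fin n) (Fin n) S)).det := by
  rw [homogCharpoly, AlgHom.map_det]
  congr 1
  ext i j
  by_cases hij : i = j
  · subst hij; simp
  · simp [hij]

lemma homogCharpoly_eq_of_charpoly_eq (t d : ℤ) {Z Z' : Matrix (Fin n) (Fin n) ℤ}
    (h : Z.charpoly = Z'.charpoly) : homogCharpoly t d Z = homogCharpoly t d Z' := by
  refine det_smul_sub_eq_of_charpoly_eq h ?_ _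
  intro h0
  have := congrArg (MvPolynomial.aeval ![(1 : ℤ), 0]) h0
  simp at this

lemma charpoly_eq_of_homogCharpoly_eq {t d : ℤ} (hd : d ≠ 0) {Z Z' : Matrix (Fin n) (Fin n) ℤ}
    (h : homogCharpoly t d Z = homogCharpoly t d Z') : Z.charpoly = Z'.charpoly := by
  apply charpoly_eq_of_det_sub_eq hd
  -- This substitution makes `x₁ - t x₂` equal to `1`.
  have h' := congrArg (MvPolynomial.aeval ![(1 + Polynomial.C t * X : ℤ[X]), X]) h
  rw [aeval_homogCharpoly, aeval_homogCharpoly] at h'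
  simpa using h'

/-- Eliminating `A 1` gives `d (x₁ A₀ + x₂ A₁) = P ((x₁ - t x₂) Z - d x₂)`. -/
lemma C_pow_mul_detForm {A : Fin 2 → Matrix (Fin n) (Fin n) ℤ} {P Z : Matrix (Fin n) (Fin n) ℤ}
    {t d : ℤ} (hP : P = -A 1 - t • A 0) (hZ : d • A 0 = P * Z) :
    MvPolynomial.C d ^ n * detForm A = MvPolynomial.C P.det * homogCharpoly t d Z := by
  have hC : (MvPolynomial.C : ℤ →+* MvPolynomial (Fin 2) ℤ) = Int.castRingHom _ :=
    RingHom.ext_int _ _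
  have h0 : ∀ j k, (MvPolynomial.C d * MvPolynomial.C (A 0 j k) : MvPolynomial (Fin 2) ℤ) =
      MvPolynomial.C ((P * Z) j k) := by
    intro j k
    rw [← hZ, ← map_mul]
    rfl
  have h1 : ∀ j k, (MvPolynomial.C (A 1 j k) : MvPolynomial (Fin 2) ℤ) =
      -MvPolynomial.C (P j k) - MvPolynomial.C t * MvPolynomial.C (A 0 j k) := by
    intro j k
    rw [hP, ← map_mul, ← map_neg, ← map_sub]
    congr 1
    simp [-zsmul_eq_mul]
  have hs : ∀ B : Matrix (Fin n) (Fin n) (MvPolynomial (Fin 2) ℤ),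
      MvPolynomial.C d ^ n * B.det = (MvPolynomial.C (σ := Fin 2) d • B).det := fun B => by
    rw [Matrix.det_smul, Fintype.card_fin]
  rw [detForm, hs, RingHom.map_det, homogCharpoly, ← Matrix.det_mul]
  congr 1
  rw [Matrix.mul_sub, Matrix.mul_smul, Matrix.mul_smul, Matrix.mul_one, ← hC,
    RingHom.mapMatrix_apply, ← Matrix.map_mul]
  ext1 j k
  simp only [Matrix.smul_apply, Matrix.add_apply, Matrix.map_apply, Matrix.sub_apply, smul_eq_mul,
    h1, ← h0]
  ring

variable {A A' : Fin 2 → Matrix (Fin n) (Fin n) ℤ} {P P' Z Z' : Matrix (Fin n) (Fin n) ℤ} {t d : ℤ}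

lemma det_eq_and_charpoly_eq_of_detForm_eq (hP : P = -A 1 - t • A 0) (hZ : d • A 0 = P * Z)
    (hP' : P' = -A' 1 - t • A' 0) (hZ' : d • A' 0 = P' * Z') (hd : d ≠ 0) (hP₀ : P'.det ≠ 0)
    {ε : ℤ} (hε : ε ≠ 0) (h : detForm A = MvPolynomial.C ε * detForm A') :
    P.det = ε * P'.det ∧ Z.charpoly = Z'.charpoly := by
  have e : MvPolynomial.C P.det * homogCharpoly t d Z =
      MvPolynomial.C (ε * P'.det) * homogCharpoly t d Z' := by
    rw [map_mul, ← C_pow_mul_detForm hP hZ, h, mul_assoc, ← C_pow_mul_detForm hP' hZ']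
    ring
  have hdet : P.det = ε * P'.det := by
    -- At the zero of `x₁ - t x₂` the factor from `Z` becomes `(-d)ⁿ`, which isolates the
    -- determinants.
    have e' := congrArg (MvPolynomial.aeval ![t, 1]) e
    simp only [map_mul, aeval_homogCharpoly, MvPolynomial.aeval_C] at e'
    simp only [mul_one, Int.cast_id, sub_self, zero_smul, zero_sub, Matrix.det_neg,
      Matrix.det_smul, Matrix.det_one, algebraMap_int_eq, eq_intCast] at e'
    refine mul_right_cancel₀ (b := (-1) ^ Fintype.card (Fin n) * d ^ Fintype.card (Fin n)) ?_ e'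
    simp [hd]
  refine ⟨hdet, charpoly_eq_of_homogCharpoly_eq hd (mul_left_cancel₀ ?_ (hdet ▸ e))⟩
  rw [Ne, MvPolynomial.C_eq_zero]
  exact mul_ne_zero hε hP₀

lemma detForm_eq_of_det_eq_of_charpoly_eq (hP : P = -A 1 - t • A 0) (hZ : d • A 0 = P * Z)
    (hP' : P' = -A' 1 - t • A' 0) (hZ' : d • A' 0 = P' * Z') (hd : d ≠ 0)
    {ε : ℤ} (hdet : P.det = ε * P'.det) (hc : Z.charpoly = Z'.charpoly) :
    detForm A = MvPolynomial.C ε * detForm A' := by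
  apply mul_left_cancel₀ (pow_ne_zero n (MvPolynomial.C_ne_zero.mpr hd))
  rw [C_pow_mul_detForm hP hZ, mul_left_comm, C_pow_mul_detForm hP' hZ', hdet,
    homogCharpoly_eq_of_charpoly_eq t d hc, map_mul, mul_assoc]

lemma det_eq_aeval_detForm (hP : P = -A 1 - t • A 0) :
    P.det = (-1) ^ n * MvPolynomial.aeval ![t, 1] (detForm A) := by
  have : P = -(t • A 0 + A 1) := by rw [hP, neg_add_rev, sub_eq_add_neg]
  rw [this, Matrix.det_neg, Fintype.card_fin, detForm, AlgHom.map_det]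
  congr 2
  ext i j
  simp [-zsmul_eq_mul]

end DetForm

/-! ### Duality, and indices as determinants of pairings -/

section DualityAndIndex

section Pairing

variable {n : ℕ} {f : Fin (n + 1) → ℤ} {M N : Type*} [AddCommGroup M] [AddCommGroup N]
  [Module (R f) M] [Module (R f) N]

/-- The pairing `M × N → I_f → J_f → ℤ`. -/
def pairing (hf : f ≠ 0) (φ : M ⊗[R f] N →ₗ[R f] I f) (ι : I f →ₗ[R f] J f) :
    M →ₗ[ℤ] N →ₗ[ℤ] ℤ :=
  LinearMap.mk₂ ℤ (fun x y => residue hf (ι (φ (x ⊗ₜ y))))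
    (fun x x' y => by simp only [TensorProduct.add_tmul, map_add])
    (fun z x y => by rw [← TensorProduct.smul_tmul', map_zsmul, map_zsmul, map_zsmul])
    (fun x y y' => by simp only [TensorProduct.tmul_add, map_add])
    (fun z x y => by rw [TensorProduct.tmul_smul, map_zsmul, map_zsmul, map_zsmul])

lemma pairing_apply (hf : f ≠ 0) (φ : M ⊗[R f] N →ₗ[R f] I f) (ι : I f →ₗ[R f] J f)
    (x : M) (y : N) : pairing hf φ ι x y = residue hf (ι (φ (x ⊗ₜ y))) := rfl

lemma pairing_smul_left (hf : f ≠ 0) (φ : M ⊗[R f] N →ₗ[R f] I f) (ι : I f →ₗ[R f] J f)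
    (r : R f) (x : M) (y : N) :
    pairing hf φ ι (r • x) y = residue hf (r • ι (φ (x ⊗ₜ y))) := by
  rw [pairing_apply, ← TensorProduct.smul_tmul', map_smul, map_smul]

lemma pairing_smul_right (hf : f ≠ 0) (φ : M ⊗[R f] N →ₗ[R f] I f) (ι : I f →ₗ[R f] J f)
    (r : R f) (x : M) (y : N) :
    pairing hf φ ι x (r • y) = residue hf (r • ι (φ (x ⊗ₜ y))) := by
  rw [pairing_apply, TensorProduct.tmul_smul, map_smul, map_smul]

/-- The matrix of the pairing `M × N → I_f → J_f → ℤ`. -/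
def pairMatrix (hf : f ≠ 0) (φ : M ⊗[R f] N →ₗ[R f] I f) (ι : I f →ₗ[R f] J f)
    (b : Module.Basis (Fin n) ℤ M) (c : Module.Basis (Fin n) ℤ N) : Matrix (Fin n) (Fin n) ℤ :=
  Matrix.of fun j k => pairing hf φ ι (b j) (c k)

/-- The matrix of the action of a function on a module. -/
def actMatrix (b : Module.Basis (Fin n) ℤ M) : R f →ₐ[ℤ] Matrix (Fin n) (Fin n) ℤ :=
  (LinearMap.toMatrixAlgEquiv b).toAlgHom.comp (Algebra.lsmul ℤ ℤ M)

lemma actMatrix_eq_toMatrix (b : Module.Basis (Fin n) ℤ M) (r : R f) :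
    actMatrix b r = LinearMap.toMatrix b b (Algebra.lsmul ℤ ℤ M r) := rfl

lemma actMatrix_apply (b : Module.Basis (Fin n) ℤ M) (r : R f) (i j : Fin n) :
    actMatrix b r i j = b.repr (r • b j) i := by
  rw [actMatrix_eq_toMatrix, LinearMap.toMatrix_apply]
  rfl

lemma charpoly_actMatrix_eq (b b' : Module.Basis (Fin n) ℤ M) (r : R f) :
    (actMatrix b r).charpoly = (actMatrix b' r).charpoly := by
  have := Module.Free.of_basis b
  have := Module.Finite.of_basis b
  rw [actMatrix_eq_toMatrix, actMatrix_eq_toMatrix, LinearMap.charpoly_toMatrix,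
    LinearMap.charpoly_toMatrix]

/-- The function `r` is moved onto the factor `N`. The hypothesis allows `ι'` to be `r • ι` divided
by an integer, after taking residues. -/
lemma pairMatrix_mul_actMatrix (hf : f ≠ 0) (φ : M ⊗[R f] N →ₗ[R f] I f)
    {ι ι' : I f →ₗ[R f] J f} (b : Module.Basis (Fin n) ℤ M) (c : Module.Basis (Fin n) ℤ N)
    {d : ℤ} {r : R f} (h : ∀ s, d * residue hf (ι' s) = residue hf (r • ι s)) :
    d • pairMatrix hf φ ι' b c = pairMatrix hf φ ι b c * actMatrix c r := by
  ext j k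
  rw [Matrix.smul_apply, Matrix.mul_apply, pairMatrix, Matrix.of_apply, pairing_apply, smul_eq_mul,
    h, ← pairing_smul_right]
  conv_lhs => rw [← c.sum_repr (r • c k)]
  rw [map_sum]
  refine Finset.sum_congr rfl fun i _ => ?_
  rw [map_zsmul, smul_eq_mul, mul_comm, actMatrix_apply]
  rfl

lemma transpose_actMatrix_mul_pairMatrix (hf : f ≠ 0) (φ : M ⊗[R f] N →ₗ[R f] I f)
    {ι ι' : I f →ₗ[R f] J f} (b : Module.Basis (Fin n) ℤ M) (c : Module.Basis (Fin n) ℤ N)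
    {d : ℤ} {r : R f} (h : ∀ s, d * residue hf (ι' s) = residue hf (r • ι s)) :
    d • pairMatrix hf φ ι' b c = (actMatrix b r).transpose * pairMatrix hf φ ι b c := by
  ext j k
  rw [Matrix.smul_apply, Matrix.mul_apply, pairMatrix, Matrix.of_apply, pairing_apply, smul_eq_mul,
    h, ← pairing_smul_left]
  conv_lhs => rw [← b.sum_repr (r • b j)]
  rw [map_sum, LinearMap.sum_apply]
  refine Finset.sum_congr rfl fun i _ => ?_
  rw [map_zsmul, LinearMap.smul_apply, smul_eq_mul, Matrix.transpose_apply, actMatrix_apply]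
  rfl

/-- If the pairing is non-degenerate, a function has the same characteristic polynomial on both
modules. -/
lemma charpoly_eq_of_det_pairMatrix_ne_zero (hf : f ≠ 0) (φ : M ⊗[R f] N →ₗ[R f] I f)
    {ι : I f →ₗ[R f] J f} (b : Module.Basis (Fin n) ℤ M) (c : Module.Basis (Fin n) ℤ N)
    (h : (pairMatrix hf φ ι b c).det ≠ 0) (r : R f) :
    (actMatrix b r).charpoly = (actMatrix c r).charpoly := by
  -- Functions are self-adjoint, because `φ` is defined on the tensor product over `R_f`.
  have e : pairMatrix hf φ ι b c * actMatrix c r =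
      (actMatrix b r).transpose * pairMatrix hf φ ι b c := by
    have hs : ∀ s, (1 : ℤ) * residue hf ((r • ι) s) = residue hf (r • ι s) := fun s => one_mul _
    rw [← pairMatrix_mul_actMatrix hf φ b c hs, ← transpose_actMatrix_mul_pairMatrix hf φ b c hs]
  set P := pairMatrix hf φ ι b c
  rw [← Matrix.charpoly_transpose (actMatrix b r)]
  have hm : ((actMatrix b r).transpose.charmatrix) * P.map Polynomial.C =
      P.map Polynomial.C * (actMatrix c r).charmatrix := by
    have e' : (actMatrix b r).transpose.map Polynomial.C * P.map Polynomial.C =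
        P.map Polynomial.C * (actMatrix c r).map Polynomial.C := by
      rw [← Matrix.map_mul, ← Matrix.map_mul, e]
    simp only [Matrix.charmatrix, RingHom.mapMatrix_apply, sub_mul, mul_sub, e']
    congr 1
    exact (Matrix.scalar_commute _ (fun r => Commute.all _ r) _).eq
  have hd := congrArg Matrix.det hm
  rw [Matrix.det_mul, Matrix.det_mul, mul_comm] at hd
  refine mul_left_cancel₀ ?_ hd
  change (Polynomial.C.mapMatrix P).det ≠ 0
  rw [← RingHom.map_det]
  simpa using h

end Pairing

section Duality

variable {m : ℕ} {f : Fin (m + 2 + 1) → ℤ} {M N : Type*} [AddCommGroup M] [AddCommGroup N]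
  [Module (R f) M] [Module (R f) N]

/-- The pairing `J_f × R_f → J_f → ℤ`. -/
def dualityMap (hf : f ≠ 0) : J f →ₗ[ℤ] Module.Dual ℤ (R f) :=
  LinearMap.mk₂ ℤ (fun s r => residue hf (r • s))
    (fun s s' r => by rw [smul_add, map_add])
    (fun z s r => by rw [smul_comm, map_zsmul])
    (fun s r r' => by rw [add_smul, map_add])
    (fun z s r => by rw [smul_assoc, map_zsmul])

/-- Duality on `T_f`: `J_f` is the `ℤ`-dual of `R_f`. -/
def dualityEquiv (hf : f ≠ 0) : J f ≃ₗ[ℤ] Module.Dual ℤ (R f) :=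
  LinearEquiv.ofIsUnitDet (f := dualityMap hf) (v := finBasisJ hf)
    (v' := (finBasisR hf).dualBasis) (by
      have h : LinearMap.toMatrix (finBasisJ hf) (finBasisR hf).dualBasis (dualityMap hf) =
          Matrix.of fun x y => residue hf (finBasisR hf x • finBasisJ hf y) := by
        ext x y
        rw [LinearMap.toMatrix_apply, Module.Basis.dualBasis_repr]
        rfl
      rw [h, det_residue_finBasis]
      exact isUnit_one)

lemma dualityEquiv_apply (hf : f ≠ 0) (s : J f) (r : R f) :
    dualityEquiv hf s r = residue hf (r • s) := rfl

lemma eq_of_residue_smul_eq (hf : f ≠ 0) {s s' : J f}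
    (h : ∀ r : R f, residue hf (r • s) = residue hf (r • s')) : s = s' :=
  (dualityEquiv hf).injective (LinearMap.ext h)

/-- Shortcut instance. -/
abbrev addCommGroupHom (f : Fin (m + 2 + 1) → ℤ) (N : Type*) [AddCommGroup N] [Module (R f) N] :
    AddCommGroup (N →ₗ[R f] J f) :=
  LinearMap.addCommGroup

attribute [local instance] addCommGroupHom

/-- `Hom_{R_f}(N, J_f)` is the `ℤ`-dual of `N`. -/
def homEquiv (hf : f ≠ 0) (N : Type*) [AddCommGroup N] [Module (R f) N] :
    (N →ₗ[R f] J f) ≃+ Module.Dual ℤ N :=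
  AddEquiv.ofBijective (AddMonoidHom.mk' (fun h => (residue hf) ∘ₗ h.toAddMonoidHom.toIntLinearMap)
    (fun h h' => by ext y; exact map_add (residue hf) (h y) (h' y))) (by
  constructor
  · intro h h' e
    ext1 y
    refine eq_of_residue_smul_eq hf fun r => ?_
    rw [← map_smul, ← map_smul]
    exact LinearMap.congr_fun e (r • y)
  · intro l
    -- The value at `y` is the element of `J_f` that represents the functional `r ↦ l (r y)` on
    -- `R_f`.
    let g : N → J f := fun y =>
      (dualityEquiv hf).symm
        (l ∘ₗ (LinearMap.toSpanSingleton (R f) N y).toAddMonoidHom.toIntLinearMap)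
    have hg : ∀ y (r : R f), residue hf (r • g y) = l (r • y) := by
      intro y r
      rw [← dualityEquiv_apply, LinearEquiv.apply_symm_apply]
      rfl
    refine ⟨⟨⟨g, fun y y' => ?_⟩, fun r y => ?_⟩, ?_⟩
    · refine eq_of_residue_smul_eq hf fun r => ?_
      rw [hg, smul_add, smul_add, map_add, map_add, hg, hg]
    · refine eq_of_residue_smul_eq hf fun r' => ?_
      rw [hg, RingHom.id_apply, ← mul_smul, ← mul_smul, hg]
    · ext y
      have := hg y 1
      rw [one_smul, one_smul] at this
      exact this)

/-- `[Hom_{R_f}(N, J_f) : M]` is the absolute value of the determinant of the pairing. -/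
lemma index_range_toHom (hf : f ≠ 0) (φ : M ⊗[R f] N →ₗ[R f] I f)
    (b : Module.Basis (Fin (m + 2)) ℤ M) (c : Module.Basis (Fin (m + 2)) ℤ N) :
    ∀ ι : I f →ₗ[R f] J f, (LinearMap.range (toHom φ ι)).toAddSubgroup.index =
      (pairMatrix hf φ ι b c).det.natAbs := by
  intro ι
  let c' := c.dualBasis.map (homEquiv hf N).toIntLinearEquiv.symm
  have h := index_range_eq_natAbs_det b c' (toHom φ ι).toAddMonoidHom.toIntLinearMap
  have e : (LinearMap.toMatrix b c' (toHom φ ι).toAddMonoidHom.toIntLinearMap).transpose =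
      pairMatrix hf φ ι b c := by
    ext j k
    rw [Matrix.transpose_apply, LinearMap.toMatrix_apply, Module.Basis.map_repr]
    change c.dualBasis.repr (homEquiv hf N (toHom φ ι (b j))) k = _
    rw [Module.Basis.dualBasis_repr]
    rfl
  rw [← e, Matrix.det_transpose, ← h]
  rfl

/-- The canonical map `I_f ⊗ R_f → I_f`. -/
abbrev canonicalMap (f : Fin (m + 2 + 1) → ℤ) : I f ⊗[R f] R f →ₗ[R f] I f :=
  (TensorProduct.rid (R f) (I f)).toLinearMap

/-- The basis of `J_f` dual to `finBasisR`. -/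
def dualBasisJ (hf : f ≠ 0) : Module.Basis (Fin (m + 2)) ℤ (J f) :=
  (finBasisR hf).dualBasis.map (dualityEquiv hf).symm

lemma transpose_toMatrix (hf : f ≠ 0) (ι : I f →ₗ[R f] J f) :
    (LinearMap.toMatrix (finBasisI hf) (dualBasisJ hf) ι.toAddMonoidHom.toIntLinearMap).transpose =
      pairMatrix hf (canonicalMap f) ι (finBasisI hf) (finBasisR hf) := by
  ext j k
  rw [Matrix.transpose_apply, LinearMap.toMatrix_apply, dualBasisJ, Module.Basis.map_repr]
  change (finBasisR hf).dualBasis.repr (dualityEquiv hf (ι (finBasisI hf j))) k = _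
  rw [Module.Basis.dualBasis_repr, dualityEquiv_apply, pairMatrix, Matrix.of_apply, pairing_apply,
    ← map_smul]
  congr 2

lemma index_range (hf : f ≠ 0) (ι : I f →ₗ[R f] J f) :
    (LinearMap.range ι).toAddSubgroup.index =
      (pairMatrix hf (canonicalMap f) ι (finBasisI hf) (finBasisR hf)).det.natAbs := by
  rw [← transpose_toMatrix, Matrix.det_transpose, ← index_range_eq_natAbs_det]
  rfl

lemma injective_iff_det_pairMatrix (hf : f ≠ 0) (ι : I f →ₗ[R f] J f) :
    Function.Injective ι ↔
      (pairMatrix hf (canonicalMap f) ι (finBasisI hf) (finBasisR hf)).det ≠ 0 := by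
  rw [← transpose_toMatrix, Matrix.det_transpose, ← injective_iff_det_ne_zero]
  rfl

end Duality

end DualityAndIndex

/-! ### Multiplication by `x₁ - t x₂`, and functions as polynomials in `x₂ / (x₁ - t x₂)` -/

section Generators

section Nondegenerate

variable {n : ℕ} {f : Fin (n + 1) → ℤ} {M N : Type*} [AddCommGroup M] [AddCommGroup N]
  [Module (R f) M] [Module (R f) N]

lemma pairMatrix_mulIJ (hf : f ≠ 0) (φ : M ⊗[R f] N →ₗ[R f] I f) (u v : ℤ)
    (b : Module.Basis (Fin n) ℤ M) (c : Module.Basis (Fin n) ℤ N) :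
    pairMatrix hf φ (mulIJ f u v) b c =
      v • balancingMatrix φ b c 0 - u • balancingMatrix φ b c 1 := by
  ext j k
  exact residue_mulIJ hf u v _

lemma toMatrix_pairing_flip (hf : f ≠ 0) (φ : M ⊗[R f] N →ₗ[R f] I f) (ι : I f →ₗ[R f] J f)
    (b : Module.Basis (Fin n) ℤ M) (c : Module.Basis (Fin n) ℤ N) :
    LinearMap.toMatrix c b.dualBasis (pairing hf φ ι).flip = pairMatrix hf φ ι b c := by
  ext j k
  rw [LinearMap.toMatrix_apply, Module.Basis.dualBasis_repr]
  rfl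

lemma toMatrix_pairing (hf : f ≠ 0) (φ : M ⊗[R f] N →ₗ[R f] I f) (ι : I f →ₗ[R f] J f)
    (b : Module.Basis (Fin n) ℤ M) (c : Module.Basis (Fin n) ℤ N) :
    LinearMap.toMatrix b c.dualBasis (pairing hf φ ι) = (pairMatrix hf φ ι b c).transpose := by
  ext j k
  rw [LinearMap.toMatrix_apply, Module.Basis.dualBasis_repr]
  rfl

lemma pairing_flip_injective (hf : f ≠ 0) {φ : M ⊗[R f] N →ₗ[R f] I f} {ι : I f →ₗ[R f] J f}
    {b : Module.Basis (Fin n) ℤ M} {c : Module.Basis (Fin n) ℤ N}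
    (h : (pairMatrix hf φ ι b c).det ≠ 0) : Function.Injective (pairing hf φ ι).flip := by
  rwa [injective_iff_det_ne_zero c b.dualBasis, toMatrix_pairing_flip]

lemma pairing_injective (hf : f ≠ 0) {φ : M ⊗[R f] N →ₗ[R f] I f} {ι : I f →ₗ[R f] J f}
    {b : Module.Basis (Fin n) ℤ M} {c : Module.Basis (Fin n) ℤ N}
    (h : (pairMatrix hf φ ι b c).det ≠ 0) : Function.Injective (pairing hf φ ι) := by
  rwa [injective_iff_det_ne_zero b c.dualBasis, toMatrix_pairing, Matrix.det_transpose]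

lemma toHom_id_injective (hf : f ≠ 0) {φ : M ⊗[R f] N →ₗ[R f] I f} {ι : I f →ₗ[R f] J f}
    {b : Module.Basis (Fin n) ℤ M} {c : Module.Basis (Fin n) ℤ N}
    (h : (pairMatrix hf φ ι b c).det ≠ 0) :
    Function.Injective (toHom φ (LinearMap.id : I f →ₗ[R f] I f)) := by
  intro x x' hx
  apply pairing_injective hf h
  ext y
  have := LinearMap.congr_fun hx y
  have h' : φ (x ⊗ₜ y) = φ (x' ⊗ₜ y) := this
  rw [pairing_apply, pairing_apply, h']

end Nondegenerate

section Canonical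

variable {m : ℕ} {f : Fin (m + 2 + 1) → ℤ}

lemma balancingMatrix_canonicalMap (hf : f ≠ 0) :
    detForm (balancingMatrix (canonicalMap f) (finBasisI hf) (finBasisR hf)) =
      -toMvPolynomial f := by
  rw [← detForm_canonical hf]
  rfl

lemma aeval_toMvPolynomial (t : ℤ) :
    MvPolynomial.aeval ![t, 1] (toMvPolynomial f) = (dehom₂ f).eval t := by
  simp [toMvPolynomial, dehom₂, eval_finsetSum]

lemma exists_eval_dehom₂_ne_zero (hf : f ≠ 0) : ∃ t : ℤ, (dehom₂ f).eval t ≠ 0 := by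
  by_contra! h
  exact dehom₂_ne_zero hf (Polynomial.funext fun t => by rw [h, Polynomial.eval_zero])

lemma det_pairMatrix_canonical_ne_zero (hf : f ≠ 0) {t : ℤ} (ht : (dehom₂ f).eval t ≠ 0) :
    (pairMatrix hf (canonicalMap f) (mulIJ f 1 (-t)) (finBasisI hf) (finBasisR hf)).det ≠ 0 := by
  rw [det_eq_aeval_detForm (t := t)
    (A := balancingMatrix (canonicalMap f) (finBasisI hf) (finBasisR hf)),
    balancingMatrix_canonicalMap, map_neg, aeval_toMvPolynomial]
  · simpa using ht
  · rw [pairMatrix_mulIJ, one_smul, neg_smul]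
    abel

lemma mulIJ_injective (hf : f ≠ 0) {t : ℤ} (ht : (dehom₂ f).eval t ≠ 0) :
    Function.Injective (mulIJ f 1 (-t)) :=
  (injective_iff_det_pairMatrix hf _).mpr (det_pairMatrix_canonical_ne_zero hf ht)

lemma pairing_canonicalMap (hf : f ≠ 0) (ι : I f →ₗ[R f] J f) (s : I f) (r : R f) :
    pairing hf (canonicalMap f) ι s r = residue hf (r • ι s) := by
  rw [pairing_apply, ← map_smul]
  rfl

/-- Up to an integer factor, every map `I_f → J_f` is a multiple of any given one that has
non-zero determinant. -/
lemma exists_residue_eq_smul (hf : f ≠ 0) {t : ℤ} (ht : (dehom₂ f).eval t ≠ 0)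
    (ι : I f →ₗ[R f] J f) : ∃ e : ℤ, e ≠ 0 ∧ ∃ κ : R f, ∀ s,
      e * residue hf (ι s) = residue hf (κ • mulIJ f 1 (-t) s) := by
  -- Non-degeneracy embeds `R_f` in the dual of `I_f` with finite index, so a multiple of the
  -- functional `residue ∘ ι` comes from `R_f`.
  obtain ⟨e, he, κ, hκ⟩ := exists_smul_mem_range (finBasisR hf) (finBasisI hf).dualBasis
    (pairing hf (canonicalMap f) (mulIJ f 1 (-t))).flip
    (pairing_flip_injective hf (det_pairMatrix_canonical_ne_zero hf ht))
    (residue hf ∘ₗ ι.toAddMonoidHom.toIntLinearMap)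
  refine ⟨e, he, κ, fun s => ?_⟩
  rw [← pairing_canonicalMap]
  exact (LinearMap.congr_fun hκ s).symm

/-- Up to an integer factor, `x₂ / (x₁ - t x₂)` is a global function on `T_f`. -/
lemma exists_linForm_mul_eq (hf : f ≠ 0) {t : ℤ} (ht : (dehom₂ f).eval t ≠ 0) :
    ∃ d : ℤ, d ≠ 0 ∧ ∃ ζ : R f, linForm f 1 (-t) * ζ.1 = d • linForm f 0 1 := by
  let c : Module.Basis (Fin (m + 2)) ℤ (sections f 1) :=
    (sectionBasis hf (κ := 2) (μ := m) (by ring) (by norm_num)).reindex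
      (finSumFinEquiv.trans (finCongr (add_comm 2 m)))
  let g : R f →ₗ[ℤ] sections f 1 :=
    ((mulForm f (zero_add (1 : ℤ)).symm 1 (-t)).toAddMonoidHom.comp
      (functionsEquiv f).toLinearMap.toAddMonoidHom).toIntLinearMap
  have hgv : ∀ r, (g r).1 = linForm f 1 (-t) * r.1 := fun _ => rfl
  -- A function killed by `x₁ - t x₂` pairs to zero with all of `I_f`. Hence `R_f` has finite index
  -- in `Γ(T_f, 𝒪(1))`, and a multiple of `x₂` lies in its image.
  have hg : Function.Injective g := by
    rw [← LinearMap.ker_eq_bot, LinearMap.ker_eq_bot']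
    intro r hr
    apply pairing_flip_injective hf (det_pairMatrix_canonical_ne_zero hf ht)
    ext s
    rw [map_zero, LinearMap.flip_apply, pairing_canonicalMap, ← map_smul]
    have h0 : mulIJ f 1 (-t) (r • s) = 0 := by
      apply Subtype.ext
      change linForm f 1 (-t) * (r.1 * s.1) = 0
      rw [← mul_assoc, ← hgv, hr]
      exact zero_mul _
    rw [h0]
    simp
  obtain ⟨d, hd, ζ, hζ⟩ := exists_smul_mem_range (finBasisR hf) c g hg
    (mulForm f (zero_add (1 : ℤ)).symm 0 1 (functionsEquiv f 1))
  refine ⟨d, hd, ζ, ?_⟩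
  rw [← hgv, hζ]
  change d • (linForm f 0 1 * 1) = _
  rw [mul_one]

lemma linForm_pow_mul_mem (u v : ℤ) (r : R f) (j : ℕ) :
    linForm f u v ^ j * r.1 ∈ sections f j := by
  induction j with
  | zero =>
    rw [pow_zero, one_mul]
    exact (functionsEquiv f r).2
  | succ j ih =>
    rw [pow_succ', mul_assoc]
    exact linForm_mul_mem (by push_cast; ring) u v ih

lemma linForm_mul_add_eq {t d : ℤ} {ζ : R f}
    (hζ : linForm f 1 (-t) * ζ.1 = d • linForm f 0 1) :
    linForm f 1 (-t) * (d • 1 + t • ζ : R f).1 = d • linForm f 1 0 := by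
  have e := linForm_eq (f := f) 1 (-t)
  change linForm f 1 (-t) * (d • 1 + t • ζ.1) = _
  simp only [zsmul_eq_mul] at hζ e ⊢
  push_cast at e
  linear_combination (d : Chart₂ f × Chart₁ f) * e + (t : Chart₂ f × Chart₁ f) * hζ

/-- Up to the factor `d`, both `x₁` and `x₂` are multiples of `x₁ - t x₂`, so their powers also kill
`r`, as `Γ(T_f, 𝒪(n - 1))` is torsion-free. On each chart one of them is `1`. -/
lemma eq_zero_of_linForm_pow_mul_eq_zero (hf : f ≠ 0) {t d : ℤ} (hd : d ≠ 0) {ζ : R f}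
    (hζ : linForm f 1 (-t) * ζ.1 = d • linForm f 0 1) {r : R f}
    (hr : linForm f 1 (-t) ^ (m + 1) * r.1 = 0) : r = 0 := by
  have key : ∀ (u v : ℤ) (η : R f), linForm f 1 (-t) * η.1 = d • linForm f u v →
      linForm f u v ^ (m + 1) * r.1 = 0 := by
    intro u v η hη
    let b := sectionBasis (f := f) hf (κ := m + 2) (μ := 0) (k := ((m + 1 : ℕ) : ℤ)) (by ring)
      (by push_cast; ring)
    let s : sections f ((m + 1 : ℕ) : ℤ) := ⟨_, linForm_pow_mul_mem u v r (m + 1)⟩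
    have hs : d ^ (m + 1) • s = 0 := by
      apply Subtype.ext
      change d ^ (m + 1) • (linForm f u v ^ (m + 1) * r.1) = 0
      rw [← smul_mul_assoc, ← _root_.smul_pow, ← hη, mul_pow, mul_right_comm, hr, zero_mul]
    exact congrArg Subtype.val ((b.smul_eq_zero.mp hs).resolve_left (pow_ne_zero _ hd))
  have h2 := key 0 1 ζ hζ
  have h1 := key 1 0 _ (linForm_mul_add_eq hζ)
  apply Subtype.ext
  refine Prod.ext ?_ ?_
  · simpa [linForm] using congrArg Prod.fst h2
  · simpa [linForm] using congrArg Prod.snd h1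

/-- Up to an integer factor, every global function on `T_f` is a polynomial in
`x₂ / (x₁ - t x₂)`. -/
lemma exists_smul_eq_aeval (hf : f ≠ 0) {t d : ℤ} (hd : d ≠ 0) {ζ : R f}
    (hζ : linForm f 1 (-t) * ζ.1 = d • linForm f 0 1) (r : R f) :
    ∃ p : ℤ[X], d ^ (m + 1) • r = aeval ζ p := by
  -- Since `μ = 0`, `Γ(T_f, 𝒪(n - 1))` has a basis of monomials only. So `(x₁ - t x₂)ⁿ⁻¹ r` is a
  -- form of degree `n - 1` in `x₁, x₂`; dividing the linear form out again turns `d x₂` into `ζ`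
  -- and `d x₁` into `d + t ζ`.
  let b := sectionBasis (f := f) hf (κ := m + 2) (μ := 0) (k := ((m + 1 : ℕ) : ℤ)) (by ring)
    (by push_cast; ring)
  let s : sections f ((m + 1 : ℕ) : ℤ) := ⟨_, linForm_pow_mul_mem 1 (-t) r (m + 1)⟩
  let η : R f := d • 1 + t • ζ
  have hη : linForm f 1 (-t) * η.1 = d • linForm f 1 0 := linForm_mul_add_eq hζ
  have hmon : ∀ i : Fin (m + 2), d ^ (m + 1) • (b (.inl i)).1 =
      linForm f 1 (-t) ^ (m + 1) * (η ^ (i : ℕ) * ζ ^ (m + 1 - i : ℕ) : R f).1 := by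
    intro i
    have h1 : (b (.inl i)).1 = linForm f 1 0 ^ (i : ℕ) * linForm f 0 1 ^ (m + 1 - i : ℕ) := by
      rw [sectionBasis_apply]
      ext <;> simp [sectionFamily, mkSection, linForm]
    have hp : m + 1 = (i : ℕ) + (m + 1 - i) := by omega
    rw [h1]
    change _ = _ * (η.1 ^ (i : ℕ) * ζ.1 ^ (m + 1 - i : ℕ))
    generalize m + 1 - (i : ℕ) = j at hp
    rw [hp]
    calc d ^ ((i : ℕ) + j) • (linForm f 1 0 ^ (i : ℕ) * linForm f 0 1 ^ j)
        = (d • linForm f 1 0) ^ (i : ℕ) * (d • linForm f 0 1) ^ j := by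
          simp only [zsmul_eq_mul]
          push_cast
          ring
      _ = _ := by
          rw [← hη, ← hζ]
          ring
  refine ⟨∑ i : Fin (m + 2), Polynomial.C (b.repr s (.inl i)) *
    ((Polynomial.C d + Polynomial.C t * X) ^ (i : ℕ) * X ^ (m + 1 - i : ℕ)), ?_⟩
  have hp : aeval ζ (∑ i : Fin (m + 2), Polynomial.C (b.repr s (.inl i)) *
      ((Polynomial.C d + Polynomial.C t * X) ^ (i : ℕ) * X ^ (m + 1 - i : ℕ))) =
      ∑ i : Fin (m + 2), b.repr s (.inl i) • (η ^ (i : ℕ) * ζ ^ (m + 1 - i : ℕ)) := by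
    simp only [map_sum, map_mul, map_pow, map_add, aeval_X, η, zsmul_eq_mul, mul_one,
      eq_intCast, map_intCast]
  rw [hp, ← sub_eq_zero]
  refine eq_zero_of_linForm_pow_mul_eq_zero hf hd hζ ?_
  have hs : linForm f 1 (-t) ^ (m + 1) * r.1 =
      ∑ i : Fin (m + 2), b.repr s (.inl i) • (b (.inl i)).1 := by
    have := congrArg Subtype.val (b.sum_repr s)
    rw [Fintype.sum_sum_type, Finset.univ_eq_empty (α := Fin 0), Finset.sum_empty, add_zero,
      AddSubmonoidClass.coe_finsetSum] at this
    exact this.symm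
  have hval : (d ^ (m + 1) • r -
      ∑ i : Fin (m + 2), b.repr s (.inl i) • (η ^ (i : ℕ) * ζ ^ (m + 1 - i : ℕ)) : R f).1 =
      d ^ (m + 1) • r.1 - ∑ i : Fin (m + 2), b.repr s (.inl i) •
        (η ^ (i : ℕ) * ζ ^ (m + 1 - i : ℕ) : R f).1 := by
    rw [AddSubgroupClass.coe_sub, AddSubmonoidClass.coe_finsetSum]
    rfl
  rw [hval, mul_sub, mul_smul_comm, hs, Finset.smul_sum, Finset.mul_sum, ← Finset.sum_sub_distrib]
  refine Finset.sum_eq_zero fun i _ => ?_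
  rw [smul_comm, hmon, mul_smul_comm, sub_self]

end Canonical

end Generators

/-! ### Comparison with the canonical pair -/

section Comparison

variable {m : ℕ} {f : Fin (m + 2 + 1) → ℤ} {M N : Type*} [AddCommGroup M] [AddCommGroup N]
  [Module (R f) M] [Module (R f) N]

lemma charpoly_actMatrix_eq_of_charpoly_eq (hf : f ≠ 0) {t d : ℤ} (hd : d ≠ 0) {ζ : R f}
    (hζ : linForm f 1 (-t) * ζ.1 = d • linForm f 0 1)
    {b : Module.Basis (Fin (m + 2)) ℤ M} {c : Module.Basis (Fin (m + 2)) ℤ N}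
    (h : (actMatrix b ζ).charpoly = (actMatrix c ζ).charpoly) (r : R f) :
    (actMatrix b r).charpoly = (actMatrix c r).charpoly := by
  obtain ⟨p, hp⟩ := exists_smul_eq_aeval hf hd hζ r
  apply charpoly_eq_of_charpoly_smul_eq (pow_ne_zero (m + 1) hd)
  rw [← map_zsmul, ← map_zsmul, hp, ← aeval_algHom_apply, ← aeval_algHom_apply]
  exact charpoly_aeval_eq_of_charpoly_eq h p

lemma det_actMatrix_eq_of_charpoly_eq
    {b : Module.Basis (Fin (m + 2)) ℤ M} {c : Module.Basis (Fin (m + 2)) ℤ N} {r : R f}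
    (h : (actMatrix b r).charpoly = (actMatrix c r).charpoly) :
    (actMatrix b r).det = (actMatrix c r).det := by
  rw [Matrix.det_eq_sign_charpoly_coeff, Matrix.det_eq_sign_charpoly_coeff, h]

lemma residue_linForm (hf : f ≠ 0) {t d : ℤ} {ζ : R f}
    (hζ : linForm f 1 (-t) * ζ.1 = d • linForm f 0 1) (s : I f) :
    d * residue hf (mulIJ f 0 1 s) = residue hf (ζ • mulIJ f 1 (-t) s) := by
  rw [← smul_eq_mul, ← map_zsmul]
  congr 1
  apply Subtype.ext
  change d • (linForm f 0 1 * s.1) = ζ.1 * (linForm f 1 (-t) * s.1)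
  rw [← smul_mul_assoc, ← hζ]
  ring

lemma smul_balancingMatrix_eq (hf : f ≠ 0) (φ : M ⊗[R f] N →ₗ[R f] I f) {t d : ℤ} {ζ : R f}
    (hζ : linForm f 1 (-t) * ζ.1 = d • linForm f 0 1)
    (b : Module.Basis (Fin (m + 2)) ℤ M) (c : Module.Basis (Fin (m + 2)) ℤ N) :
    d • balancingMatrix φ b c 0 = pairMatrix hf φ (mulIJ f 1 (-t)) b c * actMatrix c ζ := by
  rw [← pairMatrix_mul_actMatrix hf φ b c (residue_linForm hf hζ), pairMatrix_mulIJ, one_smul,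
    zero_smul, sub_zero]

lemma pairMatrix_eq_balancingMatrix (hf : f ≠ 0) (φ : M ⊗[R f] N →ₗ[R f] I f) (t : ℤ)
    (b : Module.Basis (Fin (m + 2)) ℤ M) (c : Module.Basis (Fin (m + 2)) ℤ N) :
    pairMatrix hf φ (mulIJ f 1 (-t)) b c =
      -balancingMatrix φ b c 1 - t • balancingMatrix φ b c 0 := by
  rw [pairMatrix_mulIJ, one_smul, neg_smul]
  abel

lemma pow_mul_det_pairMatrix (hf : f ≠ 0) (φ : M ⊗[R f] N →ₗ[R f] I f)
    {ι ι' : I f →ₗ[R f] J f} (b : Module.Basis (Fin (m + 2)) ℤ M)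
    (c : Module.Basis (Fin (m + 2)) ℤ N)
    {e : ℤ} {κ : R f} (h : ∀ s, e * residue hf (ι' s) = residue hf (κ • ι s)) :
    e ^ (m + 2) * (pairMatrix hf φ ι' b c).det =
      (pairMatrix hf φ ι b c).det * (actMatrix c κ).det := by
  rw [← Matrix.det_mul, ← pairMatrix_mul_actMatrix hf φ b c h, Matrix.det_smul, Fintype.card_fin]

/-- In terms of the canonical pair `(I_f, R_f)`: the determinants of `A₁ x₁ + A₂ x₂` agree up to
sign if and only if the determinants of the pairings given by `ι` do and functions have the same
characteristic polynomials. -/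
lemma exists_detForm_eq_iff (hf : f ≠ 0) (φ : M ⊗[R f] N →ₗ[R f] I f) {ι : I f →ₗ[R f] J f}
    (hι : Function.Injective ι) (b : Module.Basis (Fin (m + 2)) ℤ M)
    (c : Module.Basis (Fin (m + 2)) ℤ N) :
    (detForm (balancingMatrix φ b c) = toMvPolynomial f ∨
      detForm (balancingMatrix φ b c) = -toMvPolynomial f) ↔
    (pairMatrix hf φ ι b c).det.natAbs =
      (pairMatrix hf (canonicalMap f) ι (finBasisI hf) (finBasisR hf)).det.natAbs ∧
    ∀ r : R f, (actMatrix c r).charpoly = (actMatrix (finBasisR hf) r).charpoly := by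
  obtain ⟨t, ht⟩ := exists_eval_dehom₂_ne_zero hf
  obtain ⟨d, hd, ζ, hζ⟩ := exists_linForm_mul_eq hf ht
  obtain ⟨e, he, κ, hκ⟩ := exists_residue_eq_smul hf ht ι
  have he' : e ^ (m + 2) ≠ 0 := pow_ne_zero _ he
  have hκc := pow_mul_det_pairMatrix hf φ b c hκ
  have hκR := pow_mul_det_pairMatrix hf (canonicalMap f) (finBasisI hf) (finBasisR hf) hκ
  have hP₀ := det_pairMatrix_canonical_ne_zero hf ht
  have hB₀ := (injective_iff_det_pairMatrix hf ι).mp hι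
  have hcan := balancingMatrix_canonicalMap hf
  constructor
  · intro h
    obtain ⟨ε, hε, h⟩ : ∃ ε : ℤ, (ε = 1 ∨ ε = -1) ∧ detForm (balancingMatrix φ b c) =
        MvPolynomial.C ε * detForm (balancingMatrix (canonicalMap f) (finBasisI hf)
          (finBasisR hf)) := by
      rw [hcan]
      rcases h with h | h
      · exact ⟨-1, Or.inr rfl, by rw [h]; simp⟩
      · exact ⟨1, Or.inl rfl, by rw [h]; simp⟩
    obtain ⟨hdet, hc⟩ := det_eq_and_charpoly_eq_of_detForm_eq
      (pairMatrix_eq_balancingMatrix hf φ t b c) (smul_balancingMatrix_eq hf φ hζ b c)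
      (pairMatrix_eq_balancingMatrix hf _ t _ _) (smul_balancingMatrix_eq hf _ hζ _ _) hd hP₀
      (by rcases hε with rfl | rfl <;> norm_num) h
    have hall := charpoly_actMatrix_eq_of_charpoly_eq hf hd hζ hc
    refine ⟨?_, hall⟩
    rw [hdet, det_actMatrix_eq_of_charpoly_eq (hall κ), mul_assoc, ← hκR, mul_left_comm] at hκc
    rw [mul_left_cancel₀ he' hκc, Int.natAbs_mul]
    rcases hε with rfl | rfl <;> simp
  · rintro ⟨hB, hall⟩
    -- Injectivity of `ι` makes the factor relating the two maps `I_f → J_f` cancellable.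
    have hκ₀ : (actMatrix (finBasisR hf) κ).det ≠ 0 := by
      intro h0
      rw [h0, mul_zero] at hκR
      exact (mul_ne_zero he' hB₀) hκR
    rw [det_actMatrix_eq_of_charpoly_eq (hall κ)] at hκc
    obtain ⟨ε, hε, hεB⟩ : ∃ ε : ℤ, (ε = 1 ∨ ε = -1) ∧ (pairMatrix hf φ ι b c).det =
        ε * (pairMatrix hf (canonicalMap f) ι (finBasisI hf) (finBasisR hf)).det := by
      rcases Int.natAbs_eq_natAbs_iff.mp hB with h | h
      · exact ⟨1, Or.inl rfl, by rw [h, one_mul]⟩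
      · exact ⟨-1, Or.inr rfl, by rw [h, neg_one_mul]⟩
    have hdet : (pairMatrix hf φ (mulIJ f 1 (-t)) b c).det = ε * (pairMatrix hf (canonicalMap f)
        (mulIJ f 1 (-t)) (finBasisI hf) (finBasisR hf)).det := by
      refine mul_right_cancel₀ hκ₀ ?_
      rw [← hκc, hεB, mul_assoc, ← hκR]
      ring
    have h := detForm_eq_of_det_eq_of_charpoly_eq
      (pairMatrix_eq_balancingMatrix hf φ t b c) (smul_balancingMatrix_eq hf φ hζ b c)
      (pairMatrix_eq_balancingMatrix hf _ t _ _) (smul_balancingMatrix_eq hf _ hζ _ _) hd hdet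
      (hall ζ)
    rw [hcan] at h
    rw [h]
    rcases hε with rfl | rfl
    · right; simp
    · left; simp

end Comparison

end BinaryForm

end

theorem proposition5p1 {n : ℕ} (hn : 2 ≤ n) (f : Fin (n + 1) → ℤ) (hf : f ≠ 0)
    {M N : Type*} [AddCommGroup M] [AddCommGroup N]
    [Module (BinaryForm.R f) M] [Module (BinaryForm.R f) N]
    [Module.Free ℤ M] [Module.Finite ℤ M] (hM : Module.finrank ℤ M = n)
    [Module.Free ℤ N] [Module.Finite ℤ N] (hN : Module.finrank ℤ N = n)
    (φ : M ⊗[BinaryForm.R f] N →ₗ[BinaryForm.R f] BinaryForm.I f) :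
    (∃ ι : BinaryForm.I f →ₗ[BinaryForm.R f] BinaryForm.J f, Function.Injective ι) ∧
    ∀ ι : BinaryForm.I f →ₗ[BinaryForm.R f] BinaryForm.J f, Function.Injective ι →
      (BinaryForm.IsBalancedPair φ ↔
        Function.Injective (BinaryForm.toHom φ LinearMap.id) ∧
        (LinearMap.range (BinaryForm.toHom φ ι)).toAddSubgroup.index =
          (LinearMap.range ι).toAddSubgroup.index ∧
        (BinaryForm.IsCharacteristic f M ∨ BinaryForm.IsCharacteristic f N)) := by
  obtain ⟨m, rfl⟩ : ∃ m, n = m + 2 := ⟨n - 2, by omega⟩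
  obtain ⟨t, ht⟩ := BinaryForm.exists_eval_dehom₂_ne_zero hf
  refine ⟨⟨_, BinaryForm.mulIJ_injective hf ht⟩, fun ι hι => ⟨?_, ?_⟩⟩
  · rintro ⟨b, c, h⟩
    obtain ⟨hB, hall⟩ := (BinaryForm.exists_detForm_eq_iff hf φ hι b c).mp h
    have hB₀ := (BinaryForm.injective_iff_det_pairMatrix hf ι).mp hι
    refine ⟨BinaryForm.toHom_id_injective hf (ι := ι) (b := b) (c := c) ?_, ?_,
      Or.inr ⟨c, BinaryForm.finBasisR hf, hall⟩⟩
    · rwa [← Int.natAbs_ne_zero, hB, Int.natAbs_ne_zero]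
    · rw [BinaryForm.index_range hf, ← hB]
      exact BinaryForm.index_range_toHom hf φ b c ι
  · rintro ⟨-, hi, hc⟩
    let b := Module.finBasisOfFinrankEq ℤ M hM
    let c := Module.finBasisOfFinrankEq ℤ N hN
    refine ⟨b, c, (BinaryForm.exists_detForm_eq_iff hf φ hι b c).mpr ?_⟩
    have hB := (BinaryForm.index_range_toHom hf φ b c ι).symm.trans
      (hi.trans (BinaryForm.index_range hf ι))
    refine ⟨hB, fun r => ?_⟩
    have hB₀ := (BinaryForm.injective_iff_det_pairMatrix hf ι).mp hι
    rcases hc with ⟨b', c', h⟩ | ⟨b', c', h⟩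
    -- The index of `ι` is finite, so the pairing is non-degenerate and the property passes from `M`
    -- to `N`.
    · rw [← BinaryForm.charpoly_eq_of_det_pairMatrix_ne_zero hf φ (ι := ι) b c (by
        rwa [← Int.natAbs_ne_zero, hB, Int.natAbs_ne_zero]),
        BinaryForm.charpoly_actMatrix_eq b b', BinaryForm.charpoly_actMatrix_eq _ c']
      exact h r
    · rw [BinaryForm.charpoly_actMatrix_eq c b', BinaryForm.charpoly_actMatrix_eq _ c']
      exact h r
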